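/- For every integer $d\ge 5$ there is a finite set $A\subset\mathbb Z^d$ which tiles $\mathbb Z^d$ by translation but is not spectral in $\mathbb Z^d$, and such that the finite union of unit cubes $E=A+[0,1)^d\subset\mathbb R^d$, as well as its interior (a bounded open set), tiles $\mathbb R^d$ by translation but is not spectral in $\mathbb R^d$. In particular, each of the groups $\mathbb Z^d$ and $\mathbb R^d$, $d\ge 5$, contains a set that tiles the group by translation but is not spectral. Here $G=\mathbb Z^d$ carries the discrete topology and counting measure, and $G=\mathbb R^d$ the usual topology and Lebesgue measure. A set $\Omega\subseteq G$ tiles $G$ by translation if there is a set $T\subseteq G$ with $\sum_{t\in T}\chi_\Omega(x-t)=1$ for almost every $x\in G$. A measurable set $\Omega$ of finite measure is spectral if there is a set $\Lambda$ of continuous characters of $G$ (continuous homomorphisms from $G$ to the unit circle) which forms an orthogonal basis of the Hilbert space $L^2(\Omega)$. -/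

import Mathlib

open MeasureTheory

noncomputable section

/-- `T` is a tiling complement of `Ω` in the group `G` with Haar measure `μ`:
`∑_{t ∈ T} χ_Ω (x - t) = 1` for almost every `x`. The sum is taken in `[0, ∞]`. -/
def IsTilingComplement {G : Type*} [AddCommGroup G] [MeasurableSpace G]
    (μ : Measure G) (Ω T : Set G) : Prop :=
  ∀ᵐ x ∂μ, ∑' t : T, Ω.indicator (fun _ => (1 : ENNReal)) (x - (t : G)) = 1

/-- `Ω` tiles `G` by translation. -/
def TilesByTranslation {G : Type*} [AddCommGroup G] [MeasurableSpace G]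
    (μ : Measure G) (Ω : Set G) : Prop :=
  ∃ T : Set G, IsTilingComplement μ Ω T

/-- The set `Λ` of characters of `G` is a spectrum of the set `Ω` (of finite measure): its elements
are continuous characters, they are pairwise orthogonal in `L²(Ω)`, and their classes in `L²(Ω)`
have dense linear span; that is, `Λ` is an orthogonal basis of the Hilbert space `L²(Ω)`. -/
structure IsSpectrum {G : Type*} [AddCommGroup G] [TopologicalSpace G] [MeasurableSpace G]
    (μ : Measure G) (Ω : Set G) (Λ : Set (AddChar G Circle)) : Prop where
  continuous : ∀ χ ∈ Λ, Continuous χ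
  orthogonal : ∀ χ ∈ Λ, ∀ ψ ∈ Λ, χ ≠ ψ →
    ∫ x in Ω, (χ x : ℂ) * (starRingEnd ℂ) (ψ x : ℂ) ∂μ = 0
  complete : (Submodule.span ℂ {f : Lp ℂ 2 (μ.restrict Ω) |
    ∃ χ ∈ Λ, f =ᵐ[μ.restrict Ω] fun x => (χ x : ℂ)}).topologicalClosure = ⊤

/-- `Ω` is spectral: it has a spectrum. -/
def IsSpectral {G : Type*} [AddCommGroup G] [TopologicalSpace G] [MeasurableSpace G]
    (μ : Measure G) (Ω : Set G) : Prop :=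
  ∃ Λ : Set (AddChar G Circle), IsSpectrum μ Ω Λ

/-- The set `A + [0,1)^d` in `ℝ^d`, for a finite set `A` of points of `ℤ^d`: a finite union of
unit cubes placed at points with integer coordinates. -/
def unionOfUnitCubes {d : ℕ} (A : Finset (Fin d → ℤ)) : Set (Fin d → ℝ) :=
  ⋃ a ∈ A, {x | ∀ i, x i ∈ Set.Ico (a i : ℝ) ((a i : ℝ) + 1)}

end

/-! ### Fourier transforms and packings in finite groups. -/

open Finset

/-! The example starts in `(ℤ/114)^d`, with `114 = 6 · 19`. The residue of `x i₀` mod 19 places `x`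
in one of 19 layers, and in layer `v` the tile is the kernel of a linear form `L_v` mod 6. The
points `0` and `19 e_i` for the first five `i` do not change the layer, and each `L_v` maps these
six points bijectively onto `ℤ/6`; so they form a tiling complement (`existsUnique_crossPoint`).

At suitable frequencies of order three the Fourier transform of the tile is a sum of character sums
over subgroups, hence nonnegative, and positive as soon as one of the characters is trivial. The
forms are chosen so that this happens at all differences of six such frequencies
(`charSum_layeredTile_ne_zero`). An orthogonal set with a sixth of the elements of the group would
then be tiled against these six points, also within the 3-torsion subgroup, whose order is odd: a
contradiction (`card_lt_of_packing_torsion`).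

Many periods of the tile in a large box form a finite set `A ⊆ ℤ^d`. By pigeonhole, `#A` orthogonal
real frequencies would give too large an orthogonal set in the finite group
(`exists_card_lt_card_liftBox`). In `ℤ^d` Parseval forces `#A` frequencies. In `ℝ^d` a unit cube
contains at most `#A - 1` frequencies of a spectrum, whereas Parseval for small cubes forces average
density at least `#A` (`not_isSpectral_unionOfUnitCubes`). -/

/-- The Fourier transform of the indicator function of a set `B ⊆ (ℤ/N)^d`. -/
noncomputable def charSum {d N : ℕ} [NeZero N] (B : Finset (Fin d → ZMod N))
    (a : Fin d → ZMod N) : ℂ :=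
  ∑ x ∈ B, ZMod.stdAddChar (a ⬝ᵥ x)

lemma charSum_zero {d N : ℕ} [NeZero N] (B : Finset (Fin d → ZMod N)) :
    charSum B 0 = #B := by
  simp [charSum]

lemma card_eq_mul_of_existsUnique {G : Type*} [AddCommGroup G] [Fintype G] [DecidableEq G]
    {B T : Finset G} (h : ∀ g, ∃! t, t ∈ T ∧ g - t ∈ B) : Fintype.card G = #B * #T := by
  rw [← card_product, ← card_univ]
  symm
  apply card_bij (fun p _ => p.1 + p.2) (by simp)
  · rintro ⟨b, t⟩ hp ⟨b', t'⟩ hp' e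
    simp only [mem_product] at hp hp' e
    have := (h (b + t)).unique ⟨hp.2, by simpa using hp.1⟩
      ⟨hp'.2, by rw [e]; simpa using hp'.1⟩
    subst this
    simpa using e
  · intro g _
    obtain ⟨t, ht, -⟩ := h g
    exact ⟨(g - t, t), by simpa using ht.symm, by simp⟩

/-- A set whose difference set avoids the nonzero differences of six points of order three has less
than a sixth of the elements of the group. -/
lemma card_lt_of_packing_torsion {G : Type*} [AddCommGroup G] [Fintype G] [DecidableEq G]
    {n : ℕ} (hn : Fintype.card G = n * 6) (F : G → Prop) (h0 : ¬ F 0) (C : Fin 6 → G)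
    (hC : ∀ k l, k ≠ l → ¬ F (C k - C l)) (hinj : Function.Injective C)
    (h3 : ∀ k, 3 • C k = 0)
    (S : Finset G) (hS : ∀ a ∈ S, ∀ b ∈ S, a ≠ b → F (a - b)) : #S < n := by
  by_contra! hle
  have inj : Set.InjOn (fun p : G × Fin 6 => p.1 + C p.2) ↑(S ×ˢ (univ : Finset (Fin 6))) := by
    rintro ⟨s, k⟩ hs ⟨s', l⟩ hs' e
    simp only [coe_product, coe_univ, Set.mem_prod, Finset.mem_coe, Set.mem_univ, and_true]
      at hs hs' e
    by_cases hss : s = s'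
    · subst hss
      simp only [add_right_inj] at e
      rw [hinj e]
    · exfalso
      have h1 := hS s hs s' hs' hss
      have h2 : s - s' = C l - C k := by
        rw [sub_eq_sub_iff_add_eq_add, e, add_comm]
      rw [h2] at h1
      by_cases hkl : l = k
      · subst hkl; simp at h1; exact h0 h1
      · exact hC l k hkl h1
  -- The packing has at least as many points as the group, so it is a tiling.
  have surj : (S ×ˢ (univ : Finset (Fin 6))).image (fun p => p.1 + C p.2) = univ := by
    apply eq_univ_of_card
    apply le_antisymm (card_le_univ _)
    rw [card_image_of_injOn inj, hn, card_product]
    simpa using Nat.mul_le_mul_right 6 hle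
  let H : AddSubgroup G := (nsmulAddMonoidHom (α := G) 3).ker
  have memH : ∀ g, g ∈ H ↔ 3 • g = 0 := fun g => by simp [H, AddMonoidHom.mem_ker]
  -- All `C k` lie in `H`, so `s + C k` is in `H` exactly when `s` is: the tiling restricts to `H`,
  -- and 6 divides its order.
  have cardH : Nat.card H = #(S.filter fun s => 3 • s = 0) * 6 := by
    have : (univ.filter fun g : G => 3 • g = 0) =
        ((S.filter fun s => 3 • s = 0) ×ˢ (univ : Finset (Fin 6))).image
          (fun p => p.1 + C p.2) := by
      ext g
      simp only [mem_filter, mem_univ, true_and, mem_image, mem_product, and_true, Prod.exists]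
      constructor
      · intro hg
        have : g ∈ (S ×ˢ (univ : Finset (Fin 6))).image (fun p => p.1 + C p.2) := by
          rw [surj]; simp
        simp only [mem_image, mem_product, mem_univ, and_true, Prod.exists] at this
        obtain ⟨s, k, hs, e⟩ := this
        refine ⟨s, k, ⟨hs, ?_⟩, e⟩
        rw [← e, smul_add, h3, add_zero] at hg
        exact hg
      · rintro ⟨s, k, ⟨-, hs⟩, rfl⟩
        rw [smul_add, hs, h3, add_zero]
    rw [Nat.card_eq_fintype_card, Fintype.card_subtype]
    simp only [memH]
    rw [this, card_image_of_injOn, card_product]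
    · simp
    · refine inj.mono ?_
      intro p hp
      simp only [coe_product, Set.mem_prod, Finset.mem_coe, mem_filter] at hp ⊢
      exact ⟨hp.1.1, hp.2⟩
  have : Fact (Nat.Prime 2) := ⟨Nat.prime_two⟩
  -- Cauchy's theorem gives an element of order two in a group killed by 3.
  obtain ⟨x, hx⟩ := exists_prime_addOrderOf_dvd_card' (G := H) 2
    (by rw [cardH]; exact Dvd.dvd.mul_left (by norm_num) _)
  have h3x : 3 • x = 0 := by
    have := (memH x).1 x.2
    exact Subtype.ext this
  have := addOrderOf_dvd_of_nsmul_eq_zero h3x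
  rw [hx] at this
  omega

/-! ### The layered tile in `(ℤ/114)^d`. -/

/-- For each `v`, a permutation of the residues modulo `6` which fixes `0`. -/
def layerTable : ZMod 19 → Fin 6 → ℕ :=
  -- Only the rows 0 to 14 matter. The last four repeat row 8 and bring the number of layers to 19,
  -- which is coprime to 6.
  show Fin 19 → Fin 6 → ℕ from
  ![![0, 3, 2, 5, 1, 4], ![0, 2, 3, 1, 5, 4], ![0, 2, 1, 3, 4, 5], ![0, 1, 2, 4, 3, 5],
    ![0, 1, 4, 2, 5, 3], ![0, 2, 1, 5, 4, 3], ![0, 2, 5, 1, 3, 4], ![0, 1, 3, 2, 5, 4],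
    ![0, 1, 2, 3, 4, 5], ![0, 3, 1, 2, 5, 4], ![0, 2, 5, 3, 1, 4], ![0, 2, 1, 4, 3, 5],
    ![0, 2, 1, 4, 5, 3], ![0, 2, 3, 5, 1, 4], ![0, 3, 2, 1, 5, 4], ![0, 1, 2, 3, 4, 5],
    ![0, 1, 2, 3, 4, 5], ![0, 1, 2, 3, 4, 5], ![0, 1, 2, 3, 4, 5]]

/-- Six words over `ℤ/3`, any two of which differ by a permutation of `(0, 1, 1, 2, 2)`. -/
def codeTable : Fin 6 → Fin 5 → ℤ :=
  ![![0, 0, 0, 0, 0], ![0, 1, 1, 2, 2], ![1, 0, 2, 1, 2], ![1, 2, 0, 2, 1], ![2, 1, 2, 0, 1],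
    ![2, 2, 1, 1, 0]]

lemma layerTable_bijective (v : ZMod 19) :
    Function.Bijective fun k => (layerTable v k : ZMod 6) := by
  rw [Fintype.bijective_iff_injective_and_card]
  refine ⟨?_, by simp [ZMod.card]⟩
  revert v
  unfold Function.Injective
  decide +kernel

/-- Modulo 3, the last five entries of a row of `layerTable` are an arrangement of `(0, 1, 1, 2,
2)`, as is any difference of two code words. The rows were chosen to realise all these differences
up to a scalar. -/
lemma exists_layerTable_eq_codeTable_sub (k l : Fin 6) (h : k ≠ l) :
    ∃ v : ZMod 19, ∃ s : ZMod 3, ∀ i : Fin 5,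
      (codeTable k i - codeTable l i : ZMod 3) = s * (layerTable v i.succ : ZMod 3) := by
  revert k l
  decide +kernel

/-- The weights of the linear form on `(ℤ/6)^d` used in the layer `v`. -/
def layerWeight {d : ℕ} (v : ZMod 19) (i : Fin d) : ℕ :=
  if h : (i : ℕ) < 5 then layerTable v (Fin.succ ⟨i, h⟩) else 0

/-- The words of `codeTable`, as vectors of length `d`. -/
def codeWord {d : ℕ} (k : Fin 6) (i : Fin d) : ℤ :=
  if h : (i : ℕ) < 5 then codeTable k ⟨i, h⟩ else 0

lemma exists_layerWeight_eq_codeWord_sub {d : ℕ} (k l : Fin 6) (h : k ≠ l) :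
    ∃ v : ZMod 19, ∃ s : ZMod 3, ∀ i : Fin d,
      (codeWord k i - codeWord l i : ZMod 3) = s * (layerWeight v i : ZMod 3) := by
  obtain ⟨v, s, hs⟩ := exists_layerTable_eq_codeTable_sub k l h
  refine ⟨v, s, fun i => ?_⟩
  unfold codeWord layerWeight
  split_ifs with hi
  · exact hs _
  · simp

/-- The linear form modulo `6` of the layer `v`. -/
def layerForm (d : ℕ) (v : ZMod 19) : (Fin d → ZMod 114) →+ ZMod 6 where
  toFun x := ∑ i, (layerWeight v i : ZMod 6) * ZMod.castHom (by norm_num) (ZMod 6) (x i)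
  map_zero' := by simp
  map_add' x y := by simp only [Pi.add_apply, map_add, mul_add, sum_add_distrib]

/-- The number of the layer of a point. -/
def layerIndex {d : ℕ} (i₀ : Fin d) : (Fin d → ZMod 114) →+ ZMod 19 :=
  (ZMod.castHom (by norm_num : 19 ∣ 114) (ZMod 19)).toAddMonoidHom.comp
    (Pi.evalAddMonoidHom (fun _ => ZMod 114) i₀)

lemma layerIndex_apply {d : ℕ} (i₀ : Fin d) (x : Fin d → ZMod 114) :
    layerIndex i₀ x = ZMod.castHom (by norm_num : 19 ∣ 114) (ZMod 19) (x i₀) := rfl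

lemma layerForm_apply {d : ℕ} (v : ZMod 19) (x : Fin d → ZMod 114) :
    layerForm d v x =
      ∑ i, (layerWeight v i : ZMod 6) * ZMod.castHom (by norm_num) (ZMod 6) (x i) := rfl

lemma layerForm_single {d : ℕ} (v : ZMod 19) (i : Fin d) (y : ZMod 114) :
    layerForm d v (Pi.single i y) =
      (layerWeight v i : ZMod 6) * ZMod.castHom (by norm_num) (ZMod 6) y := by
  rw [layerForm_apply, sum_eq_single i]
  · simp
  · intro j _ hj
    simp [Pi.single_eq_of_ne hj]
  · simp

/-- A tile of `(ℤ/114)^d` with no spectrum: in the layer `v`, the kernel of `layerForm d v`. -/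
def layeredTile {d : ℕ} (i₀ : Fin d) : Finset (Fin d → ZMod 114) :=
  univ.filter fun x => layerForm d (layerIndex i₀ x) x = 0

/-- The points of a tiling complement of `layeredTile`. -/
def crossPoint {d : ℕ} (hd : 5 ≤ d) : Fin 6 → Fin d → ZMod 114 :=
  Fin.cons 0 fun i => Pi.single (Fin.castLE hd i) 19

lemma layerIndex_crossPoint {d : ℕ} (hd : 5 ≤ d) (i₀ : Fin d) (k : Fin 6) :
    layerIndex i₀ (crossPoint hd k) = 0 := by
  refine Fin.cases ?_ (fun i => ?_) k
  · simp [crossPoint]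
  · rw [layerIndex_apply]
    simp only [crossPoint, Fin.cons_succ]
    by_cases h : i₀ = Fin.castLE hd i
    · rw [h, Pi.single_eq_same]; decide
    · rw [Pi.single_eq_of_ne h, map_zero]

lemma layerForm_crossPoint {d : ℕ} (hd : 5 ≤ d) (v : ZMod 19) (k : Fin 6) :
    layerForm d v (crossPoint hd k) = layerTable v k := by
  refine Fin.cases ?_ (fun i => ?_) k
  · simp only [crossPoint, Fin.cons_zero, map_zero]
    revert v; decide
  · simp only [crossPoint, Fin.cons_succ]
    rw [layerForm_single]
    have : ZMod.castHom (by norm_num : 6 ∣ 114) (ZMod 6) 19 = 1 := by decide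
    rw [this, mul_one]
    simp [layerWeight]

/-- Since `19 = 0` mod 19 and `19 = 1` mod 6, translation by a cross point keeps the layer `v` and
shifts its form by an entry of row `v`. That row is a permutation of `ℤ/6`, so exactly one
translation brings the form to 0. -/
lemma existsUnique_crossPoint {d : ℕ} (hd : 5 ≤ d) (i₀ : Fin d) (g : Fin d → ZMod 114) :
    ∃! t, t ∈ univ.image (crossPoint hd) ∧ g - t ∈ layeredTile i₀ := by
  obtain ⟨k, hk, huniq⟩ :=
    (layerTable_bijective (layerIndex i₀ g)).existsUnique (layerForm d (layerIndex i₀ g) g)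
  have key : ∀ l, g - crossPoint hd l ∈ layeredTile i₀ ↔
      (layerTable (layerIndex i₀ g) l : ZMod 6) = layerForm d (layerIndex i₀ g) g := by
    intro l
    have hidx : layerIndex i₀ (g - crossPoint hd l) = layerIndex i₀ g := by
      rw [map_sub, layerIndex_crossPoint, sub_zero]
    rw [layeredTile, mem_filter, hidx, map_sub, layerForm_crossPoint, sub_eq_zero, eq_comm]
    simp
  refine ⟨crossPoint hd k, ⟨by simp, (key k).2 hk⟩, ?_⟩
  rintro t ⟨ht, htg⟩
  obtain ⟨l, -, rfl⟩ := mem_image.1 ht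
  rw [huniq l ((key l).1 htg)]

lemma card_crossPoint {d : ℕ} (hd : 5 ≤ d) : #(univ.image (crossPoint hd)) = 6 := by
  rw [card_image_of_injective]
  · simp
  · intro k l h
    apply (layerTable_bijective 0).injective
    simp only
    rw [← layerForm_crossPoint hd, ← layerForm_crossPoint hd, h]

open scoped ComplexOrder in
-- The sum is the order of `K` if `ψ` is trivial on `K`, and 0 otherwise.
lemma AddChar.sum_addSubgroup_nonneg {G : Type*} [AddCommGroup G] (K : AddSubgroup G) [Fintype K]
    (ψ : AddChar G ℂ) : 0 ≤ ∑ x : K, ψ x := by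
  classical
  have := AddChar.sum_eq_ite (ψ.compAddMonoidHom K.subtype)
  simp only [AddChar.compAddMonoidHom_apply, AddSubgroup.coe_subtype] at this
  rw [this]
  split_ifs
  · positivity
  · exact le_rfl

open scoped ComplexOrder in
-- Each layer is a coset of a subgroup `K v`, by an element on which the character is 1. Hence no
-- phases appear: every layer contributes a nonnegative amount, and a layer whose form is
-- proportional mod 3 to the frequency contributes `#(K v)`.
lemma charSum_layeredTile_ne_zero {d : ℕ} (i₀ : Fin d) {k l : Fin 6} (hkl : k ≠ l) :
    charSum (layeredTile i₀)
      (fun i => 38 * (codeWord k i : ZMod 114) - 38 * (codeWord l i : ZMod 114)) ≠ 0 := by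
  set a : Fin d → ZMod 114 :=
    fun i => 38 * (codeWord k i : ZMod 114) - 38 * (codeWord l i : ZMod 114) with ha
  let ψ : AddChar (Fin d → ZMod 114) ℂ := ZMod.stdAddChar.compAddMonoidHom
    { toFun := fun x => a ⬝ᵥ x, map_zero' := by simp, map_add' := by simp [dotProduct_add] }
  have hψ : ∀ x, ψ x = ZMod.stdAddChar (a ⬝ᵥ x) := fun x => rfl
  let K : ZMod 19 → AddSubgroup (Fin d → ZMod 114) :=
    fun v => (layerIndex i₀).ker ⊓ (layerForm d v).ker
  classical
  have layer : ∀ v : ZMod 19, ∑ x ∈ (layeredTile i₀).filter (fun x => layerIndex i₀ x = v), ψ x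
      = ∑ x : K v, ψ x := by
    intro v
    -- `96` is 1 mod 19 and 0 mod 6: `g` moves layer 0 to layer `v` without affecting any form. As
    -- `114` divides `38 * 96`, the character is 1 at `g`.
    let g : Fin d → ZMod 114 := Pi.single i₀ (96 * (v.val : ZMod 114))
    have hg1 : layerIndex i₀ g = v := by
      rw [layerIndex_apply]
      simp only [g, Pi.single_eq_same]
      revert v; decide
    have hg2 : ∀ w, layerForm d w g = 0 := by
      intro w
      simp only [g]
      rw [layerForm_single, map_mul]
      have : ZMod.castHom (by norm_num : 6 ∣ 114) (ZMod 6) 96 = 0 := by decide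
      rw [this]; simp
    have hg3 : ψ g = 1 := by
      rw [hψ]
      simp only [g, dotProduct_single, ha]
      have : (38 * (codeWord k i₀ : ZMod 114) - 38 * (codeWord l i₀ : ZMod 114)) *
          (96 * (v.val : ZMod 114)) = (38 * 96) *
          ((codeWord k i₀ - codeWord l i₀ : ZMod 114) * (v.val : ZMod 114)) := by ring
      rw [this, show (38 * 96 : ZMod 114) = 0 by decide]
      simp
    symm
    apply sum_bij (fun (x : K v) _ => g + (x : Fin d → ZMod 114))
    · rintro ⟨x, hx⟩ -
      simp only [K, AddSubgroup.mem_inf, AddMonoidHom.mem_ker] at hx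
      simp only [mem_filter, layeredTile, mem_univ, map_add, hg1, hx.1, add_zero, hg2,
        hx.2, and_self]
    · rintro x - y - h
      exact Subtype.ext (add_left_cancel h)
    · intro x hx
      simp only [mem_filter, layeredTile, mem_univ, true_and] at hx
      refine ⟨⟨x - g, ?_⟩, mem_univ _, by simp⟩
      simp only [K, AddSubgroup.mem_inf, AddMonoidHom.mem_ker, map_sub, hg1, hg2, hx.2, sub_self,
        sub_zero, true_and]
      have := hx.1
      rwa [hx.2] at this
    · intro x _
      rw [AddChar.map_add_eq_mul, hg3, one_mul]
  have hsum : charSum (layeredTile i₀) a = ∑ v : ZMod 19, ∑ x : K v, ψ x := by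
    rw [charSum, ← sum_fiberwise (layeredTile i₀) (fun x => layerIndex i₀ x)]
    exact sum_congr rfl fun v _ => layer v
  rw [hsum]
  apply ne_of_gt
  apply sum_pos' (fun v _ => AddChar.sum_addSubgroup_nonneg (K v) ψ)
  obtain ⟨v, s, hs⟩ := exists_layerWeight_eq_codeWord_sub (d := d) k l hkl
  refine ⟨v, mem_univ _, ?_⟩
  -- A product `38 * y` depends only on `y` mod 3, and here `y` mod 3 is `s` times the form of the
  -- layer `v`, which vanishes on `K v`.
  have triv : ∀ x : K v, ψ x = 1 := by
    rintro ⟨x, hx⟩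
    simp only [K, AddSubgroup.mem_inf, AddMonoidHom.mem_ker] at hx
    have h38 : ∀ y : ZMod 114, ZMod.castHom (by norm_num : 3 ∣ 114) (ZMod 3) y = 0 →
        38 * y = 0 := by decide +kernel
    have hax : a ⬝ᵥ x = 38 * ∑ i, (codeWord k i - codeWord l i : ZMod 114) * x i := by
      rw [dotProduct, mul_sum]
      refine sum_congr rfl fun i _ => ?_
      rw [ha]; ring
    have h3 : ZMod.castHom (by norm_num : 3 ∣ 6) (ZMod 3) (layerForm d v x) =
        ∑ i, (layerWeight v i : ZMod 3) * ZMod.castHom (by norm_num : 3 ∣ 114) (ZMod 3) (x i) := by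
      rw [layerForm_apply, map_sum]
      refine sum_congr rfl fun i _ => ?_
      rw [map_mul, map_natCast]
      congr 1
      exact RingHom.congr_fun (RingHom.ext_zmod ((ZMod.castHom (by norm_num : 3 ∣ 6) (ZMod 3)).comp
        (ZMod.castHom (by norm_num : 6 ∣ 114) (ZMod 6))) _) (x i)
    rw [hψ, hax, h38, AddChar.map_zero_eq_one]
    rw [map_sum]
    simp only [map_mul, map_sub, map_intCast, hs]
    simp only [mul_assoc]
    rw [← mul_sum, ← h3, hx.2, map_zero, mul_zero]
  simp only [triv]
  simp [Fintype.card_pos]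

/-- The factor `38 = 114 / 3` makes the six frequencies 3-torsion, as `card_lt_of_packing_torsion`
requires. -/
lemma card_lt_card_layeredTile {d : ℕ} (hd : 5 ≤ d) (i₀ : Fin d) (S : Finset (Fin d → ZMod 114))
    (hS : ∀ a ∈ S, ∀ b ∈ S, a ≠ b → charSum (layeredTile i₀) (a - b) = 0) :
    #S < #(layeredTile i₀) := by
  have hne : ∀ k l : Fin 6, k ≠ l → charSum (layeredTile i₀)
      ((fun i => 38 * (codeWord k i : ZMod 114)) - (fun i => 38 * (codeWord l i : ZMod 114))) ≠ 0 :=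
    fun k l h => charSum_layeredTile_ne_zero i₀ h
  have hcard := card_eq_mul_of_existsUnique (existsUnique_crossPoint hd i₀)
  rw [card_crossPoint] at hcard
  have h0 : charSum (layeredTile i₀) 0 ≠ 0 := by
    rw [charSum_zero, Nat.cast_ne_zero]
    intro h
    rw [h] at hcard
    simp at hcard
  refine card_lt_of_packing_torsion hcard (fun a => charSum (layeredTile i₀) a = 0) h0
    (fun k i => 38 * (codeWord k i : ZMod 114)) hne ?_ ?_ S hS
  · intro k l h
    have : ∀ k l : Fin 6, (∀ j, 38 * (codeTable k j : ZMod 114) = 38 * (codeTable l j : ZMod 114)) →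
        k = l := by decide +kernel
    apply this
    intro j
    have := congrFun h (Fin.castLE hd j)
    simpa [codeWord] using this
  · intro k
    ext i
    simp only [Pi.smul_apply, Pi.zero_apply, nsmul_eq_mul, ← mul_assoc]
    rw [show ((3 : ℕ) : ZMod 114) * 38 = 0 by decide, zero_mul]

/-! ### From the finite group to `ℤ^d`. -/

/-- The points of the box `[0, N n)^d` whose classes modulo `N` lie in `B`. -/
def liftBox {d N : ℕ} (B : Finset (Fin d → ZMod N)) (n : ℕ) : Finset (Fin d → ℤ) :=
  (B ×ˢ (univ : Finset (Fin d → Fin n))).image fun p i => ((p.1 i).val : ℤ) + N * (p.2 i : ℕ)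

lemma liftBox_map_injective {d N n : ℕ} [NeZero N] :
    Function.Injective fun (p : (Fin d → ZMod N) × (Fin d → Fin n)) (i : Fin d) =>
      ((p.1 i).val : ℤ) + N * (p.2 i : ℕ) := by
  rintro ⟨b, k⟩ ⟨b', k'⟩ h
  have hb : ∀ i, b i = b' i := fun i => by
    have := congrArg (Int.cast : ℤ → ZMod N) (congrFun h i)
    simpa using this
  have hk : ∀ i, k i = k' i := fun i => by
    have := congrFun h i
    simp only [hb i, add_right_inj, mul_eq_mul_left_iff, Nat.cast_inj, Nat.cast_eq_zero,
      NeZero.ne N, or_false] at this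
    exact Fin.ext this
  exact Prod.ext (funext hb) (funext hk)

lemma card_liftBox {d N n : ℕ} [NeZero N] (B : Finset (Fin d → ZMod N)) :
    #(liftBox B n) = n ^ d * #B := by
  rw [liftBox, card_image_of_injective _ liftBox_map_injective, card_product]
  simp [mul_comm]

lemma mem_liftBox {d N n : ℕ} [NeZero N] {B : Finset (Fin d → ZMod N)} {x : Fin d → ℤ} :
    x ∈ liftBox B n ↔ (fun i => (x i : ZMod N)) ∈ B ∧ ∀ i, 0 ≤ x i ∧ x i < N * n := by
  have hN : (0 : ℤ) < N := by exact_mod_cast Nat.pos_of_ne_zero (NeZero.ne N)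
  simp only [liftBox, mem_image, mem_product, mem_univ, and_true, Prod.exists]
  constructor
  · rintro ⟨b, k, hb, rfl⟩
    refine ⟨by simpa using hb, fun i => ⟨by positivity, ?_⟩⟩
    have h1 : ((b i).val : ℤ) < N := by exact_mod_cast ZMod.val_lt (b i)
    have h2 : ((k i : ℕ) : ℤ) + 1 ≤ n := by exact_mod_cast (k i).2
    nlinarith
  · rintro ⟨hb, hx⟩
    have hlt : ∀ i, (x i / N).toNat < n := fun i => by
      have h0 : 0 ≤ x i / N := Int.ediv_nonneg (hx i).1 hN.le
      have : x i / N < n := Int.ediv_lt_of_lt_mul hN (by rw [mul_comm]; exact (hx i).2)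
      omega
    refine ⟨_, fun i => ⟨_, hlt i⟩, hb, ?_⟩
    ext i
    have h0 : 0 ≤ x i / N := Int.ediv_nonneg (hx i).1 hN.le
    simp only [ZMod.val_intCast, Int.toNat_of_nonneg h0]
    exact Int.emod_add_mul_ediv _ _

/-- Representatives of `T` settle the class mod `N`, and the lattice `N n ℤ^d` settles the position
in the box. -/
lemma existsUnique_sub_mem_liftBox {d N n : ℕ} [NeZero N] [NeZero n]
    {B T : Finset (Fin d → ZMod N)}
    (h : ∀ g, ∃! t, t ∈ T ∧ g - t ∈ B) (x : Fin d → ℤ) :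
    ∃! t, t ∈ {t : Fin d → ℤ | ∃ s ∈ T, ∃ z : Fin d → ℤ,
      t = fun i => ((s i).val : ℤ) + (N * n) * z i} ∧ x - t ∈ liftBox B n := by
  have hN : (0 : ℤ) < N := by exact_mod_cast Nat.pos_of_ne_zero (NeZero.ne N)
  have hn : (0 : ℤ) < n := by exact_mod_cast Nat.pos_of_ne_zero (NeZero.ne n)
  have hNn : (0 : ℤ) < N * n := mul_pos hN hn
  have cast_sub : ∀ (s : Fin d → ZMod N) (z : Fin d → ℤ),
      (fun i => (((x - fun i => ((s i).val : ℤ) + (N * n) * z i) i : ℤ) : ZMod N)) =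
        (fun i => (x i : ZMod N)) - s := by
    intro s z
    ext i
    simp
  obtain ⟨s, ⟨hsT, hsB⟩, huniq⟩ := h fun i => (x i : ZMod N)
  refine ⟨fun i => ((s i).val : ℤ) + (N * n) * ((x i - (s i).val) / (N * n)),
    ⟨⟨s, hsT, fun i => (x i - (s i).val) / (N * n), rfl⟩, ?_⟩, ?_⟩
  · rw [mem_liftBox]
    refine ⟨by rw [cast_sub]; exact hsB, fun i => ?_⟩
    have h1 := Int.emod_nonneg (x i - (s i).val) hNn.ne'
    have h2 := Int.emod_lt_of_pos (x i - (s i).val) hNn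
    have h3 := Int.emod_add_mul_ediv (x i - (s i).val) (N * n)
    simp only [Pi.sub_apply]
    constructor <;> linarith
  · rintro _ ⟨⟨s', hs'T, z, rfl⟩, hx⟩
    rw [mem_liftBox, cast_sub] at hx
    obtain rfl := huniq s' ⟨hs'T, hx.1⟩
    ext i
    have h3 := hx.2 i
    simp only [Pi.sub_apply] at h3
    congr 2
    symm
    rw [Int.ediv_eq_iff_of_pos hNn]
    constructor <;> nlinarith [h3.1, h3.2]

/-- The exponential sum over a finite set of points of `ℤ^d`. -/
noncomputable def expSum {d : ℕ} (A : Finset (Fin d → ℤ)) (θ : Fin d → ℝ) : ℂ :=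
  ∑ x ∈ A, (Real.fourierChar (∑ i, θ i * x i) : ℂ)

lemma AddChar.map_sum_eq_prod' {ι A M : Type*} [AddCommMonoid A] [CommMonoid M] (ψ : AddChar A M)
    (s : Finset ι) (f : ι → A) : ψ (∑ i ∈ s, f i) = ∏ i ∈ s, ψ (f i) := by
  classical
  induction s using Finset.induction_on with
  | empty => simp
  | insert i s hi ih => rw [sum_insert hi, prod_insert hi, AddChar.map_add_eq_mul, ih]

/-- The lifted set is a direct sum of representatives of `B` and a dilated discrete cube, so its
transform is a product. -/
lemma expSum_liftBox {d N n : ℕ} [NeZero N] (B : Finset (Fin d → ZMod N)) (θ : Fin d → ℝ) :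
    expSum (liftBox B n) θ =
      (∑ b ∈ B, (Real.fourierChar (∑ i, θ i * ((b i).val : ℕ)) : ℂ)) *
        ∏ i, ∑ k : Fin n, (Real.fourierChar (θ i * (N * (k : ℕ))) : ℂ) := by
  rw [expSum, liftBox, sum_image liftBox_map_injective.injOn, sum_product, sum_mul]
  refine sum_congr rfl fun b _ => ?_
  rw [prod_univ_sum, mul_sum, Fintype.piFinset_univ]
  refine sum_congr rfl fun k _ => ?_
  push_cast
  simp only [mul_add, sum_add_distrib]
  rw [AddChar.map_add_eq_mul, AddChar.map_sum_eq_prod' _ _ fun i => θ i * (N * (k i : ℕ)),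
    Circle.coe_mul]
  congr 1
  exact map_prod Circle.coeHom _ _

lemma Real.fourierChar_intCast (m : ℤ) : Real.fourierChar (m : ℝ) = 1 := by
  ext
  rw [Real.fourierChar_apply, Circle.coe_one, Complex.exp_eq_one_iff]
  exact ⟨m, by push_cast; ring⟩

lemma Real.exists_intCast_of_fourierChar_eq_one {x : ℝ} (h : Real.fourierChar x = 1) :
    ∃ m : ℤ, x = m := by
  have h' : (Real.fourierChar x : ℂ) = 1 := by rw [h, Circle.coe_one]
  rw [Real.fourierChar_apply, Complex.exp_eq_one_iff] at h'
  obtain ⟨m, hm⟩ := h'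
  refine ⟨m, ?_⟩
  have hpi : (Real.pi : ℂ) ≠ 0 := by exact_mod_cast Real.pi_ne_zero
  have h2 : (x : ℂ) * (2 * Real.pi * Complex.I) = m * (2 * Real.pi * Complex.I) := by
    rw [← hm]; push_cast; ring
  have := mul_right_cancel₀ (by simp [hpi]) h2
  exact_mod_cast this

lemma Real.norm_fourierChar_sub_le (x y : ℝ) :
    ‖(Real.fourierChar x : ℂ) - Real.fourierChar y‖ ≤ 2 * Real.pi * |x - y| := by
  have h : (Real.fourierChar x : ℂ) = Real.fourierChar y * Real.fourierChar (x - y) := by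
    rw [← Circle.coe_mul, ← AddChar.map_add_eq_mul, add_sub_cancel]
  rw [h, show ∀ a b : ℂ, a * b - a = a * (b - 1) from fun a b => by ring, norm_mul,
    Circle.norm_coe, one_mul, Real.fourierChar_apply, mul_comm _ Complex.I]
  refine (Real.norm_exp_I_mul_ofReal_sub_one_le).trans ?_
  rw [Real.norm_eq_abs, abs_mul, abs_of_pos (by positivity : (0 : ℝ) < 2 * Real.pi)]

/-- A geometric sum with ratio `z = e(δ / n)` vanishes only if `z ≠ 1` and `z ^ n = e(δ) = 1`, which
`|δ| < 1` excludes. -/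
lemma sum_fourierChar_ne_zero {n : ℕ} [NeZero n] {t δ : ℝ} {q : ℤ} (ht : t = q + δ / n)
    (hδ : |δ| < 1) : ∑ k : Fin n, (Real.fourierChar (t * (k : ℕ)) : ℂ) ≠ 0 := by
  have hn : (n : ℝ) ≠ 0 := by exact_mod_cast NeZero.ne n
  set z : Circle := Real.fourierChar (δ / n) with hz
  have hterm : ∀ k : ℕ, Real.fourierChar (t * k) = z ^ k := by
    intro k
    rw [ht, add_mul, AddChar.map_add_eq_mul, hz, ← AddChar.map_nsmul_eq_pow]
    have : Real.fourierChar ((q : ℝ) * k) = 1 := by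
      exact_mod_cast Real.fourierChar_intCast (q * k)
    rw [this, one_mul, nsmul_eq_mul, mul_comm]
  simp only [hterm, Circle.coe_pow]
  rw [Fin.sum_univ_eq_sum_range (fun k => (z : ℂ) ^ k)]
  intro h0
  by_cases h1 : (z : ℂ) = 1
  · rw [h1] at h0
    simp [NeZero.ne n] at h0
  · have h2 := mul_geom_sum (z : ℂ) n
    rw [h0, mul_zero] at h2
    have h3 : Real.fourierChar δ = 1 := by
      have : Real.fourierChar δ = z ^ n := by
        rw [hz, ← AddChar.map_nsmul_eq_pow, nsmul_eq_mul, mul_div_cancel₀ _ hn]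
      rw [this, Circle.ext_iff, Circle.coe_pow, Circle.coe_one]
      exact (sub_eq_zero.1 h2.symm)
    obtain ⟨m, hm⟩ := Real.exists_intCast_of_fourierChar_eq_one h3
    have hm0 : m = 0 := by
      rw [hm] at hδ
      have : |m| < 1 := by exact_mod_cast hδ
      exact Int.abs_lt_one_iff.1 this
    apply h1
    rw [hz, hm, hm0]
    simp

lemma charSum_intCast {d N : ℕ} [NeZero N] (B : Finset (Fin d → ZMod N)) (a : Fin d → ℤ) :
    charSum B (fun i => (a i : ZMod N)) =
      ∑ b ∈ B, (Real.fourierChar (∑ i, (a i : ℝ) / N * ((b i).val : ℕ)) : ℂ) := by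
  refine sum_congr rfl fun b _ => ?_
  have : (fun i => (a i : ZMod N)) ⬝ᵥ b = ((∑ i, a i * ((b i).val : ℤ) : ℤ) : ZMod N) := by
    simp [dotProduct]
  rw [this, ZMod.stdAddChar_coe, Real.fourierChar_apply]
  congr 1
  push_cast
  rw [mul_sum, sum_div, mul_sum, sum_mul]
  refine sum_congr rfl fun i _ => ?_
  ring

lemma norm_sum_sub_charSum_le {d N n : ℕ} [NeZero N] [NeZero n] (B : Finset (Fin d → ZMod N))
    {θ δ : Fin d → ℝ} {q : Fin d → ℤ} (hθ : ∀ i, N * θ i = q i + δ i / n) (hδ : ∀ i, |δ i| < 1) :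
    ‖(∑ b ∈ B, (Real.fourierChar (∑ i, θ i * ((b i).val : ℕ)) : ℂ)) -
      charSum B (fun i => (q i : ZMod N))‖ ≤ #B * (2 * Real.pi * d) / n := by
  have hN : (0 : ℝ) < N := by exact_mod_cast Nat.pos_of_ne_zero (NeZero.ne N)
  have hn : (0 : ℝ) < n := by exact_mod_cast Nat.pos_of_ne_zero (NeZero.ne n)
  rw [charSum_intCast, ← sum_sub_distrib]
  refine (norm_sum_le_of_le B (f := fun b => _) (n := fun _ => 2 * Real.pi * d / n) ?_).trans ?_
  · intro b _
    refine (Real.norm_fourierChar_sub_le _ _).trans ?_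
    rw [← sum_sub_distrib, mul_div_assoc]
    refine mul_le_mul_of_nonneg_left ?_ (by positivity)
    refine (abs_sum_le_sum_abs _ _).trans ?_
    refine (sum_le_sum (g := fun _ => 1 / (n : ℝ)) ?_).trans ?_
    · intro i _
      have h1 : θ i = (q i : ℝ) / N + δ i / n / N := by
        rw [← add_div, ← hθ]; field_simp
      rw [h1, add_mul, add_sub_cancel_left, abs_mul, abs_div, abs_div, abs_of_pos hn,
        abs_of_pos hN, Nat.abs_cast]
      have h2 : ((b i).val : ℝ) ≤ N := by exact_mod_cast (ZMod.val_lt (b i)).le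
      rw [div_div, div_mul_eq_mul_div, div_le_div_iff₀ (by positivity) hn, one_mul]
      have h3 : |δ i| * ((b i).val : ℝ) ≤ 1 * N :=
        mul_le_mul (hδ i).le h2 (by positivity) zero_le_one
      nlinarith
    · simp [div_eq_mul_inv]
  · rw [sum_const, nsmul_eq_mul]
    exact le_of_eq (by ring)

/-- Among `n ^ d * #B` frequencies, `#B` share a cell, so for their differences `N θ` is within `1 /
n` of an integer vector. The cube factor of `expSum_liftBox` is then nonzero, the other factor
vanishes, and `charSum B` at the integer vector is too small to be nonzero. -/
lemma exists_card_lt_card_liftBox {d N : ℕ} [NeZero N] (B : Finset (Fin d → ZMod N))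
    (hB : ∀ S : Finset (Fin d → ZMod N),
      (∀ a ∈ S, ∀ b ∈ S, a ≠ b → charSum B (a - b) = 0) → #S < #B) :
    ∃ n : ℕ, n ≠ 0 ∧ ∀ S : Finset (Fin d → ℝ),
      (∀ θ ∈ S, ∀ θ' ∈ S, θ ≠ θ' → expSum (liftBox B n) (θ - θ') = 0) →
        #S < #(liftBox B n) := by
  -- `charSum B` takes finitely many values, so its nonzero values are bounded away from 0.
  obtain ⟨η, hη, hηB⟩ : ∃ η > 0, ∀ a, charSum B a ≠ 0 → η ≤ ‖charSum B a‖ := by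
    have : ∀ a : Fin d → ZMod N, ∀ᶠ η : ℝ in nhdsWithin 0 (Set.Ioi 0),
        charSum B a ≠ 0 → η ≤ ‖charSum B a‖ := by
      intro a
      by_cases h : charSum B a = 0
      · simp [h]
      · have : ∀ᶠ η : ℝ in nhds 0, η < ‖charSum B a‖ := Iio_mem_nhds (norm_pos_iff.2 h)
        filter_upwards [nhdsWithin_le_nhds this] with η hη _ using hη.le
    have hall := Filter.eventually_all.2 this
    obtain ⟨η, h1, h2⟩ := (hall.and self_mem_nhdsWithin).exists
    exact ⟨η, h2, h1⟩
  have hBpos : 0 < #B := by simpa using hB ∅ (by simp)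
  obtain ⟨n, hn⟩ := exists_nat_gt (#B * (2 * Real.pi * d) / η)
  have hn0 : (0 : ℝ) < n := lt_of_le_of_lt (by positivity) hn
  have hn0' : n ≠ 0 := by rintro rfl; simp at hn0
  have : NeZero n := ⟨hn0'⟩
  refine ⟨n, hn0', fun S hS => ?_⟩
  by_contra! hle
  rw [card_liftBox] at hle
  -- The cell records the fractional part of `N θ` to precision `1 / n`; `a θ` below is the integer
  -- part of `N θ`.
  let cell : (Fin d → ℝ) → Fin d → ZMod n := fun θ i => (⌊N * n * θ i⌋ : ZMod n)
  obtain ⟨c, -, hc⟩ := exists_le_card_fiber_of_mul_le_card_of_maps_to (s := S) (t := univ)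
    (f := cell) (n := #B) (by simp) univ_nonempty (by simpa [ZMod.card] using hle)
  let a : (Fin d → ℝ) → Fin d → ℤ := fun θ i => ⌊N * n * θ i⌋ / n
  have key : ∀ θ ∈ S.filter (fun θ => cell θ = c), ∀ θ' ∈ S.filter (fun θ => cell θ = c), θ ≠ θ' →
      charSum B ((fun i => (a θ i : ZMod N)) - (fun i => (a θ' i : ZMod N))) = 0 := by
    intro θ hθ θ' hθ' hne
    rw [mem_filter] at hθ hθ'
    have h0 := hS θ hθ.1 θ' hθ'.1 hne
    set δ : Fin d → ℝ := fun i => Int.fract (N * n * θ i) - Int.fract (N * n * θ' i) with hδ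
    have hδ1 : ∀ i, |δ i| < 1 := fun i => Int.abs_sub_lt_one_of_floor_eq_floor (by simp)
    have hdiff : ∀ i, N * (θ - θ') i = ((a θ i - a θ' i : ℤ) : ℝ) + δ i / n := by
      intro i
      have hmod : ⌊N * n * θ i⌋ % n = ⌊N * n * θ' i⌋ % n :=
        (ZMod.intCast_eq_intCast_iff _ _ n).1 (congrFun (hθ.2.trans hθ'.2.symm) i)
      have h1 := Int.emod_add_mul_ediv ⌊N * n * θ i⌋ n
      have h2 := Int.emod_add_mul_ediv ⌊N * n * θ' i⌋ n
      have h3 : ((⌊N * n * θ i⌋ - ⌊N * n * θ' i⌋ : ℤ) : ℝ) = ((n * (a θ i - a θ' i) : ℤ) : ℝ) := by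
        rw [Int.cast_inj]
        simp only [a]
        linarith
      have h4 := Int.floor_add_fract (N * n * θ i)
      have h5 := Int.floor_add_fract (N * n * θ' i)
      push_cast at h3
      simp only [Pi.sub_apply, hδ]
      push_cast
      apply mul_right_cancel₀ hn0.ne'
      rw [add_mul, div_mul_cancel₀ _ hn0.ne']
      linarith
    rw [expSum_liftBox, mul_eq_zero] at h0
    have h1 : ∏ i, ∑ k : Fin n, (Real.fourierChar ((θ - θ') i * (N * (k : ℕ))) : ℂ) ≠ 0 := by
      rw [prod_ne_zero_iff]
      intro i _
      have := sum_fourierChar_ne_zero (n := n) (hdiff i) (hδ1 i)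
      have h : ∀ k : ℝ, (θ - θ') i * (N * k) = N * (θ - θ') i * k := fun k => by ring
      simpa only [h] using this
    have h2 := norm_sum_sub_charSum_le B hdiff hδ1
    rw [h0.resolve_right h1, zero_sub, norm_neg] at h2
    have h3 : (fun i => ((a θ i - a θ' i : ℤ) : ZMod N)) =
        (fun i => (a θ i : ZMod N)) - (fun i => (a θ' i : ZMod N)) := by
      ext i; simp
    rw [h3] at h2
    by_contra hne0
    have h4 := hηB _ hne0
    rw [div_lt_iff₀ hη] at hn
    have h5 : #B * (2 * Real.pi * d) / n < η := by
      rw [div_lt_iff₀ hn0]; linarith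
    linarith
  have inj : Set.InjOn (fun θ i => (a θ i : ZMod N)) (S.filter fun θ => cell θ = c) := by
    intro θ hθ θ' hθ' h
    by_contra hne
    have := key θ hθ θ' hθ' hne
    simp only at h
    rw [h, sub_self, charSum_zero, Nat.cast_eq_zero] at this
    omega
  have := hB ((S.filter fun θ => cell θ = c).image fun θ i => (a θ i : ZMod N)) (by
    intro x hx y hy hxy
    obtain ⟨θ, hθ, rfl⟩ := mem_image.1 hx
    obtain ⟨θ', hθ', rfl⟩ := mem_image.1 hy
    exact key θ hθ θ' hθ' (fun h => hxy (by rw [h])))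
  rw [card_image_of_injOn inj] at this
  omega

/-! ### Parseval's identity for a spectrum. -/

section Parseval

variable {G : Type*} [AddCommGroup G] [TopologicalSpace G] [MeasurableSpace G] [BorelSpace G]
  {μ : Measure G} {Ω : Set G} {Λ : Set (AddChar G Circle)}

lemma memLp_coe_addChar [IsFiniteMeasure μ] {χ : AddChar G Circle} (hχ : Continuous χ) :
    MemLp (fun x => (χ x : ℂ)) 2 μ :=
  MemLp.of_bound (continuous_subtype_val.comp hχ).aestronglyMeasurable 1
    (ae_of_all _ fun x => (Circle.norm_coe (χ x)).le)

/-- Parseval's identity, for the indicator function of a subset. -/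
lemma IsSpectrum.hasSum (h : IsSpectrum μ Ω Λ) (hfin : μ Ω ≠ ⊤) (h0 : μ Ω ≠ 0) {Q : Set G}
    (hQ : MeasurableSet Q) (hQΩ : Q ⊆ Ω) :
    HasSum (fun χ : Λ => ‖∫ x in Q, (χ.1 x : ℂ) ∂μ‖ ^ 2) (μ.real Ω * μ.real Q) := by
  have : IsFiniteMeasure (μ.restrict Ω) := ⟨by simpa using hfin.lt_top⟩
  set m : ℝ := μ.real Ω with hm
  have hmpos : 0 < m := ENNReal.toReal_pos h0 hfin
  let e : Λ → Lp ℂ 2 (μ.restrict Ω) := fun χ => (memLp_coe_addChar (h.continuous χ χ.2)).toLp _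
  have he : ∀ χ : Λ, e χ =ᵐ[μ.restrict Ω] fun x => (χ.1 x : ℂ) := fun χ => MemLp.coeFn_toLp _
  -- Characters have norm `√m` in `L²(Ω)`.
  let c : ℂ := ((√m)⁻¹ : ℝ)
  have hc : c ≠ 0 := by
    simpa [c, hmpos.le] using hmpos.ne'
  have hcc : c * c = ((m⁻¹ : ℝ) : ℂ) := by
    simp only [c]
    rw [← Complex.ofReal_mul, ← mul_inv, Real.mul_self_sqrt hmpos.le]
  have hconj : (starRingEnd ℂ) c = c := Complex.conj_ofReal _
  have hinner : ∀ χ ψ : Λ, inner ℂ (e χ) (e ψ) =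
      ∫ x in Ω, (ψ.1 x : ℂ) * (starRingEnd ℂ) (χ.1 x : ℂ) ∂μ := by
    intro χ ψ
    rw [L2.inner_def]
    refine integral_congr_ae ?_
    filter_upwards [he χ, he ψ] with x h1 h2
    rw [h1, h2]
    rfl
  have horth : Orthonormal ℂ fun χ => c • e χ := by
    classical
    rw [orthonormal_iff_ite]
    intro χ ψ
    rw [inner_smul_left, inner_smul_right, hinner, hconj]
    split_ifs with hχψ
    · subst hχψ
      have : ∀ x, (χ.1 x : ℂ) * (starRingEnd ℂ) (χ.1 x : ℂ) = 1 := fun x => by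
        rw [Complex.mul_conj, Circle.normSq_coe, Complex.ofReal_one]
      simp only [this]
      rw [integral_const, measureReal_restrict_apply_univ, ← mul_assoc, hcc, ← hm]
      simp [hmpos.ne']
    · rw [h.orthogonal ψ ψ.2 χ χ.2 (fun hh => hχψ (Subtype.ext hh.symm)), mul_zero, mul_zero]
  have hspan : ⊤ ≤ (Submodule.span ℂ (Set.range fun χ => c • e χ)).topologicalClosure := by
    rw [← h.complete]
    apply Submodule.topologicalClosure_mono
    rw [Submodule.span_le]
    rintro f ⟨χ, hχ, hf⟩
    have hfe : f = e ⟨χ, hχ⟩ := Lp.ext (hf.trans (he ⟨χ, hχ⟩).symm)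
    have : f = c⁻¹ • (c • e ⟨χ, hχ⟩) := by rw [smul_smul, inv_mul_cancel₀ hc, one_smul, hfe]
    rw [this]
    exact Submodule.smul_mem _ _ (Submodule.subset_span ⟨_, rfl⟩)
  let b := HilbertBasis.mk horth hspan
  have hQfin : (μ.restrict Ω) Q ≠ ⊤ := measure_ne_top _ _
  let f := indicatorConstLp 2 hQ hQfin (1 : ℂ)
  have hres : (μ.restrict Ω).restrict Q = μ.restrict Q := by
    rw [Measure.restrict_restrict hQ, Set.inter_eq_left.2 hQΩ]
  have hfe : ∀ χ, inner ℂ f (c • e χ) = c * ∫ x in Q, (χ.1 x : ℂ) ∂μ := by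
    intro χ
    rw [inner_smul_right, L2.inner_indicatorConstLp_one, hres]
    congr 1
    refine integral_congr_ae ?_
    rw [← hres]
    exact ae_restrict_of_ae (he χ)
  have hff : inner ℂ f f = ((μ.real Q : ℝ) : ℂ) := by
    rw [L2.inner_indicatorConstLp_one, hres]
    have : (f : G → ℂ) =ᵐ[μ.restrict Q] fun _ => (1 : ℂ) := by
      have h1 : (f : G → ℂ) =ᵐ[μ.restrict Ω] Q.indicator fun _ => (1 : ℂ) := indicatorConstLp_coeFn
      rw [← hres]
      filter_upwards [ae_restrict_of_ae h1, ae_restrict_mem hQ] with x h2 h3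
      rw [h2, Set.indicator_of_mem h3]
    rw [integral_congr_ae this, integral_const, measureReal_restrict_apply_univ]
    simp
  have hsum := b.hasSum_inner_mul_inner f f
  rw [hff] at hsum
  have hterm : ∀ χ, inner ℂ f (b χ) * inner ℂ (b χ) f =
      ((m⁻¹ * ‖∫ x in Q, (χ.1 x : ℂ) ∂μ‖ ^ 2 : ℝ) : ℂ) := by
    intro χ
    rw [← inner_conj_symm (b χ) f, Complex.mul_conj, Complex.normSq_eq_norm_sq]
    have : b χ = c • e χ := by simp [b]
    rw [this, hfe, norm_mul, mul_pow]
    congr 2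
    have : ‖c * c‖ = m⁻¹ := by
      rw [hcc, Complex.norm_real, Real.norm_of_nonneg (by positivity)]
    rw [← this, norm_mul, sq]
  simp only [hterm] at hsum
  have hreal := Complex.hasSum_ofReal.1 hsum
  have := hreal.mul_left m
  simpa only [mul_inv_cancel_left₀ hmpos.ne'] using this

end Parseval

/-! ### Non-spectrality in `ℤ^d`. -/

/-- Transport of a character of `ℤ^d` to the torus. -/
lemma exists_fourierChar_int {d : ℕ} (χ : AddChar (Fin d → ℤ) Circle) :
    ∃ θ : Fin d → ℝ, ∀ x : Fin d → ℤ, χ x = Real.fourierChar (∑ i, θ i * x i) := by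
  have hsurj : ∀ z : Circle, ∃ t : ℝ, Real.fourierChar t = z := by
    intro z
    refine ⟨Complex.arg z / (2 * Real.pi), ?_⟩
    rw [Real.fourierChar_apply', mul_div_cancel₀ _ (by positivity), Circle.exp_arg]
  choose θ hθ using fun i : Fin d => hsurj (χ (Pi.single i 1))
  refine ⟨θ, fun x => ?_⟩
  have hx : x = ∑ i, x i • (Pi.single i 1 : Fin d → ℤ) := by
    rw [← Finset.univ_sum_single x]
    ext j
    simp [Pi.single_apply]
  conv_lhs => rw [hx]
  rw [AddChar.map_sum_eq_prod', AddChar.map_sum_eq_prod']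
  refine prod_congr rfl fun i _ => ?_
  rw [AddChar.map_zsmul_eq_zpow, ← hθ, ← AddChar.map_zsmul_eq_zpow, zsmul_eq_mul, mul_comm]

lemma fourierChar_sum_sub {d : ℕ} (θ θ' : Fin d → ℝ) (x : Fin d → ℝ) :
    (Real.fourierChar (∑ i, (θ - θ') i * x i) : ℂ) =
      Real.fourierChar (∑ i, θ i * x i) * (starRingEnd ℂ) (Real.fourierChar (∑ i, θ' i * x i)) := by
  rw [Circle.starRingEnd_addChar, ← Circle.coe_mul, ← AddChar.map_add_eq_mul]
  simp only [Pi.sub_apply, sub_mul, sum_sub_distrib, ← sub_eq_add_neg]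

/-- Parseval for the indicator of one point has all terms equal to 1 and sum `#A`, so a spectrum
contains `#A` orthogonal characters. -/
lemma not_isSpectral_count {d : ℕ} {A : Finset (Fin d → ℤ)}
    (hA : ∀ S : Finset (Fin d → ℝ),
      (∀ θ ∈ S, ∀ θ' ∈ S, θ ≠ θ' → expSum A (θ - θ') = 0) → #S < #A) :
    ¬ IsSpectral Measure.count (A : Set (Fin d → ℤ)) := by
  rintro ⟨Λ, hΛ⟩
  have hApos : 0 < #A := by simpa using hA ∅ (by simp)
  obtain ⟨a, ha⟩ := card_pos.1 hApos
  have hcount : Measure.count (A : Set (Fin d → ℤ)) = #A := Measure.count_apply_finset A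
  have hsum := hΛ.hasSum (by rw [hcount]; simp) (by rw [hcount]; simpa using hApos.ne')
    (measurableSet_singleton a) (by simpa using ha)
  have hone : ∀ χ : Λ, ‖∫ x in {a}, (χ.1 x : ℂ) ∂Measure.count‖ ^ 2 = 1 := by
    intro χ
    rw [integral_singleton, norm_smul, Circle.norm_coe]
    simp [Measure.real]
  have hreal : (Measure.count.real (A : Set (Fin d → ℤ))) *
      Measure.count.real ({a} : Set (Fin d → ℤ)) = #A := by
    simp [Measure.real]
  simp only [hone, hreal] at hsum
  choose θ hθ using fun χ : AddChar (Fin d → ℤ) Circle => exists_fourierChar_int χ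
  have hev := hsum.eventually (lt_mem_nhds (show (#A : ℝ) - 1 < #A by linarith))
  obtain ⟨s, hs⟩ := hev.exists
  simp only [sum_const, nsmul_eq_mul, mul_one] at hs
  have hcard : #A ≤ #s := by
    have : (#A : ℝ) < #s + 1 := by linarith
    exact Nat.lt_succ_iff.1 (by exact_mod_cast this)
  have inj : Function.Injective fun χ : Λ => θ χ.1 := by
    intro χ ψ h
    apply Subtype.ext
    ext x
    simp only at h
    rw [hθ χ.1 x, hθ ψ.1 x, h]
  have := hA (s.image fun χ : Λ => θ χ.1) (by
    intro t ht t' ht' hne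
    obtain ⟨χ, -, rfl⟩ := mem_image.1 ht
    obtain ⟨ψ, -, rfl⟩ := mem_image.1 ht'
    have hχψ : χ.1 ≠ ψ.1 := fun h => hne (by rw [h])
    have horth := hΛ.orthogonal χ.1 χ.2 ψ.1 ψ.2 hχψ
    have hint : ∀ f : (Fin d → ℤ) → ℂ, IntegrableOn f (A : Set (Fin d → ℤ)) Measure.count := by
      intro f
      have : IsFiniteMeasure (Measure.count.restrict (A : Set (Fin d → ℤ))) :=
        ⟨by rw [Measure.restrict_apply_univ, hcount]; exact ENNReal.natCast_lt_top _⟩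
      have h := IntegrableOn.finset (μ := Measure.count.restrict (A : Set (Fin d → ℤ))) (s := A)
        (f := f)
      rwa [IntegrableOn, Measure.restrict_restrict A.measurableSet, Set.inter_self] at h
    rw [setIntegral_finset _ (hint _)] at horth
    rw [expSum, ← horth]
    refine sum_congr rfl fun x _ => ?_
    rw [fourierChar_sum_sub, ← hθ, ← hθ]
    simp [Measure.real])
  rw [card_image_of_injective _ inj] at this
  omega

/-! ### Continuous characters of `ℝ^d`. -/

/-- The continuous characters of `ℝ` are the exponentials. -/
lemma exists_fourierChar_of_continuous_real {χ : AddChar ℝ Circle} (hχ : Continuous χ) :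
    ∃ t : ℝ, ∀ x, χ x = Real.fourierChar (t * x) := by
  let f : ℝ → ℂ := fun x => (χ x : ℂ)
  have hf : Continuous f := continuous_subtype_val.comp hχ
  have hadd : ∀ x y, f (x + y) = f x * f y := fun x y => by
    simp only [f, AddChar.map_add_eq_mul, Circle.coe_mul]
  have hf0 : f 0 = 1 := by simp [f]
  have hderiv : ∀ x, HasDerivAt (fun u => ∫ t in (0 : ℝ)..u, f t) (f x) x := fun x =>
    intervalIntegral.integral_hasDerivAt_right (hf.intervalIntegrable _ _)
      (hf.stronglyMeasurableAtFilter _ _) hf.continuousAt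
  obtain ⟨a, ha⟩ : ∃ a : ℝ, ∫ t in (0 : ℝ)..a, f t ≠ 0 := by
    by_contra! h
    have h1 := hderiv 0
    rw [funext h, hf0] at h1
    exact zero_ne_one ((hasDerivAt_const (0 : ℝ) (0 : ℂ)).unique h1)
  set c := ∫ t in (0 : ℝ)..a, f t with hc
  -- Averaging over an interval where the integral is nonzero shows that a continuous character is
  -- differentiable.
  have hfx : ∀ x, f x = c⁻¹ * ((∫ t in (0 : ℝ)..(x + a), f t) - ∫ t in (0 : ℝ)..x, f t) := by
    intro x
    rw [intervalIntegral.integral_interval_sub_left (hf.intervalIntegrable _ _)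
      (hf.intervalIntegrable _ _)]
    have h1 : ∫ t in x..(x + a), f t = f x * c := by
      have := intervalIntegral.integral_comp_add_left (a := 0) (b := a) f x
      rw [add_zero] at this
      rw [← this, hc, ← intervalIntegral.integral_const_mul]
      simp only [hadd]
    rw [h1]
    field_simp
  set k := c⁻¹ * (f a - 1) with hk
  have hf' : ∀ x, HasDerivAt f (k * f x) x := by
    intro x
    have h1 := (((hderiv (x + a)).comp_add_const x a).sub (hderiv x)).const_mul c⁻¹
    rw [hadd] at h1
    have h2 : c⁻¹ * (f x * f a - f x) = k * f x := by rw [hk]; ring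
    rw [h2] at h1
    exact h1.congr_of_eventuallyEq (Filter.Eventually.of_forall hfx)
  have hexp : ∀ x : ℝ, f x = Complex.exp (k * x) := by
    have hg : ∀ x : ℝ, HasDerivAt (fun x : ℝ => f x * Complex.exp (-(k * x))) 0 x := by
      intro x
      have h1 : HasDerivAt (fun x : ℝ => -(k * (x : ℂ))) (-(k * 1)) x :=
        ((Complex.ofRealCLM.hasDerivAt (x := x)).const_mul k).neg
      have h2 := (hf' x).mul h1.cexp
      exact h2.congr_deriv (by ring)
    intro x
    have h3 := is_const_of_deriv_eq_zero (fun x => (hg x).differentiableAt)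
      (fun x => (hg x).deriv) x 0
    simp only [hf0, Complex.ofReal_zero, mul_zero, neg_zero, Complex.exp_zero, mul_one] at h3
    rw [Complex.exp_neg] at h3
    field_simp at h3
    exact h3
  have hre : k.re = 0 := by
    have h1 : ‖f 1‖ = 1 := Circle.norm_coe _
    rw [hexp 1, Complex.norm_exp] at h1
    simpa using h1
  refine ⟨k.im / (2 * Real.pi), fun x => ?_⟩
  apply Circle.ext
  have hkI : k = k.im * Complex.I := by
    apply Complex.ext <;> simp [hre]
  have h2 : 2 * Real.pi * (k.im / (2 * Real.pi) * x) = k.im * x := by field_simp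
  rw [Real.fourierChar_apply, h2]
  change f x = _
  rw [hexp]
  conv_lhs => rw [hkI]
  push_cast
  ring_nf

lemma exists_fourierChar_of_continuous {d : ℕ} {χ : AddChar (Fin d → ℝ) Circle}
    (hχ : Continuous χ) :
    ∃ θ : Fin d → ℝ, ∀ x, χ x = Real.fourierChar (∑ i, θ i * x i) := by
  have h : ∀ i : Fin d, ∃ t : ℝ, ∀ x : ℝ, χ (Pi.single i x) = Real.fourierChar (t * x) := by
    intro i
    refine exists_fourierChar_of_continuous_real
      (χ := χ.compAddMonoidHom (AddMonoidHom.single (fun _ : Fin d => ℝ) i)) ?_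
    exact hχ.comp (continuous_single (A := fun _ : Fin d => ℝ) i)
  choose θ hθ using h
  refine ⟨θ, fun x => ?_⟩
  conv_lhs => rw [← Finset.univ_sum_single x]
  rw [AddChar.map_sum_eq_prod', AddChar.map_sum_eq_prod']
  exact prod_congr rfl fun i _ => hθ i (x i)

/-! ### Fourier transforms of intervals and unions of cubes. -/

lemma integral_Ico_fourierChar_mul (t a : ℝ) {ε : ℝ} (hε : 0 ≤ ε) :
    (∫ x in Set.Ico a (a + ε), (Real.fourierChar (t * x) : ℂ)) * (2 * Real.pi * Complex.I * t) =
      Real.fourierChar (t * a) * (Real.fourierChar (t * ε) - 1) := by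
  rw [integral_Ico_eq_integral_Ioc, ← intervalIntegral.integral_of_le (by linarith)]
  by_cases ht : t = 0
  · simp [ht]
  · have hc : (2 * Real.pi * Complex.I * t : ℂ) ≠ 0 := by
      simp [Real.pi_ne_zero, ht]
    have h1 : ∀ x : ℝ, (Real.fourierChar (t * x) : ℂ) =
        Complex.exp ((2 * Real.pi * Complex.I * t) * x) := fun x => by
      rw [Real.fourierChar_apply]; push_cast; ring_nf
    have h2 : (Real.fourierChar (t * a) : ℂ) * (Real.fourierChar (t * ε) - 1) =
        Real.fourierChar (t * (a + ε)) - Real.fourierChar (t * a) := by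
      rw [mul_add t, AddChar.map_add_eq_mul, Circle.coe_mul]; ring
    rw [h2]
    simp only [h1]
    rw [integral_exp_mul_complex hc, div_mul_cancel₀ _ hc]

lemma integral_Ico_add_one_fourierChar (t a : ℝ) :
    ∫ x in Set.Ico a (a + 1), (Real.fourierChar (t * x) : ℂ) =
      Real.fourierChar (t * a) * ∫ x in Set.Ico (0 : ℝ) 1, (Real.fourierChar (t * x) : ℂ) := by
  rw [integral_Ico_eq_integral_Ioc, integral_Ico_eq_integral_Ioc,
    ← intervalIntegral.integral_of_le (by linarith), ← intervalIntegral.integral_of_le zero_le_one,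
    ← intervalIntegral.integral_const_mul]
  have := intervalIntegral.integral_comp_add_left (a := 0) (b := 1)
    (fun x : ℝ => (Real.fourierChar (t * x) : ℂ)) a
  rw [add_zero] at this
  rw [← this]
  simp only [mul_add, AddChar.map_add_eq_mul, Circle.coe_mul]

lemma integral_Ico_zero_one_fourierChar_ne_zero {t : ℝ} (ht : |t| < 1) :
    ∫ x in Set.Ico (0 : ℝ) 1, (Real.fourierChar (t * x) : ℂ) ≠ 0 := by
  intro h
  have h1 := integral_Ico_fourierChar_mul t 0 zero_le_one
  rw [zero_add, h, zero_mul, mul_zero, AddChar.map_zero_eq_one, Circle.coe_one, one_mul, mul_one,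
    eq_comm, sub_eq_zero, Circle.coe_eq_one] at h1
  obtain ⟨m, rfl⟩ := Real.exists_intCast_of_fourierChar_eq_one h1
  have hm : m = 0 := Int.abs_lt_one_iff.1 (by exact_mod_cast ht)
  subst hm
  simp at h

lemma norm_integral_Ico_fourierChar_le (t a : ℝ) {ε : ℝ} (hε : 0 ≤ ε) :
    ‖∫ x in Set.Ico a (a + ε), (Real.fourierChar (t * x) : ℂ)‖ ≤ ε := by
  refine (norm_setIntegral_le_of_norm_le_const (C := 1) (by simp) ?_).trans ?_
  · intro x _
    exact (Circle.norm_coe _).le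
  · simp [Measure.real, hε]

lemma norm_integral_Ico_fourierChar {t : ℝ} (ht : t ≠ 0) (a : ℝ) {ε : ℝ} (hε : 0 ≤ ε) :
    ‖∫ x in Set.Ico a (a + ε), (Real.fourierChar (t * x) : ℂ)‖ =
      |Real.sin (Real.pi * ε * |t|)| / (Real.pi * |t|) := by
  have h1 := congrArg norm (integral_Ico_fourierChar_mul t a hε)
  rw [norm_mul, norm_mul (Real.fourierChar (t * a) : ℂ), Circle.norm_coe, one_mul,
    Real.fourierChar_apply (t * ε), mul_comm ((2 * Real.pi * (t * ε) : ℝ) : ℂ) Complex.I,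
    Complex.norm_exp_I_mul_ofReal_sub_one] at h1
  have h2 : ‖(2 * Real.pi * Complex.I * t : ℂ)‖ = 2 * (Real.pi * |t|) := by
    simp [abs_of_pos Real.pi_pos, mul_assoc]
  have h3 : |Real.sin (Real.pi * ε * |t|)| = |Real.sin (2 * Real.pi * (t * ε) / 2)| := by
    rcases abs_cases t with ⟨h, -⟩ | ⟨h, -⟩
    · rw [h]; congr 2; ring
    · rw [h, ← abs_neg, ← Real.sin_neg]; congr 2; ring
  have h4 : (0 : ℝ) < Real.pi * |t| := mul_pos Real.pi_pos (abs_pos.2 ht)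
  rw [h2, Real.norm_eq_abs, abs_mul, abs_two] at h1
  rw [h3, eq_div_iff h4.ne']
  linarith

/-- Write `sin²` through the cosine of the double angle and use the Fourier series of the second
Bernoulli polynomial. The term `n = 0` is 0 by division by zero. -/
lemma hasSum_sin_sq_div_sq {x : ℝ} (hx : x ∈ Set.Icc (0 : ℝ) 1) :
    HasSum (fun n : ℕ => (Real.sin (Real.pi * x * n) / (Real.pi * n)) ^ 2) ((x - x ^ 2) / 2) := by
  have h1 := hasSum_one_div_nat_pow_mul_cos one_ne_zero hx
  have h2 := (hasSum_zeta_two.sub h1).mul_left (1 / (2 * Real.pi ^ 2))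
  convert! h2 using 1
  · ext n
    have : Real.cos (2 * Real.pi * n * x) = 1 - 2 * Real.sin (Real.pi * x * n) ^ 2 := by
      rw [show 2 * Real.pi * n * x = 2 * (Real.pi * x * n) by ring, Real.cos_two_mul,
        Real.cos_sq']
      ring
    rw [this]
    rcases eq_or_ne (n : ℝ) 0 with hn | hn
    · simp [hn]
    · field_simp
      ring
  · have : (Polynomial.map (algebraMap ℚ ℝ) (Polynomial.bernoulli (2 * 1))).eval x
        = x ^ 2 - x + 1 / 6 := by
      simp [Polynomial.bernoulli, sum_range_succ, bernoulli_two, bernoulli_one,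
        Polynomial.eval_add]
      ring
    rw [this]
    norm_num [Nat.factorial]
    field_simp
    ring

lemma add_sq_le_of_pos {a b δ : ℝ} (hδ : 0 < δ) :
    (a + b) ^ 2 ≤ (1 + δ) * a ^ 2 + (1 + 1 / δ) * b ^ 2 := by
  have h : (1 + δ) * a ^ 2 + (1 + 1 / δ) * b ^ 2 - (a + b) ^ 2 = (δ * a - b) ^ 2 / δ := by
    field_simp
    ring
  have : 0 ≤ (δ * a - b) ^ 2 / δ := by positivity
  linarith

/-- A majorant of the squared Fourier coefficients of an interval of length `ε`, on the
interval of frequencies `[k, k + 1]`. -/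
noncomputable def sincBound (ε δ : ℝ) (k : ℕ) : ℝ :=
  (1 + δ) * (Real.sin (Real.pi * ε * k) / (Real.pi * k)) ^ 2 +
    -- At `k = 0` the other terms are 0 by division by zero, and the trivial bound `ε ^ 2` replaces
    -- them.
    (1 + 1 / δ) * ε ^ 2 * (1 / (k : ℝ) ^ 2) + if k = 0 then ε ^ 2 else 0

lemma hasSum_sincBound {ε : ℝ} (hε : ε ∈ Set.Icc (0 : ℝ) 1) (δ : ℝ) :
    HasSum (sincBound ε δ)
      ((1 + δ) * ((ε - ε ^ 2) / 2) + (1 + 1 / δ) * ε ^ 2 * (Real.pi ^ 2 / 6) + ε ^ 2) :=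
  (((hasSum_sin_sq_div_sq hε).mul_left (1 + δ)).add
    (hasSum_zeta_two.mul_left ((1 + 1 / δ) * ε ^ 2))).add (hasSum_ite_eq 0 (ε ^ 2))

lemma sincBound_nonneg {ε δ : ℝ} (hδ : 0 < δ) (k : ℕ) : 0 ≤ sincBound ε δ k := by
  unfold sincBound
  have : 0 ≤ if k = 0 then ε ^ 2 else 0 := by split_ifs <;> positivity
  positivity

lemma norm_integral_Ico_fourierChar_sq_le {ε δ : ℝ} (hε : 0 ≤ ε) (hδ : 0 < δ) {t : ℝ} {k : ℕ}
    (hk : (k : ℝ) ≤ |t|) (hk' : |t| ≤ k + 1) (a : ℝ) :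
    ‖∫ x in Set.Ico a (a + ε), (Real.fourierChar (t * x) : ℂ)‖ ^ 2 ≤ sincBound ε δ k := by
  rcases Nat.eq_zero_or_pos k with rfl | hkpos
  · have h := norm_integral_Ico_fourierChar_le t a hε
    have : sincBound ε δ 0 = ε ^ 2 := by simp [sincBound]
    rw [this]
    gcongr
  · have hkr : (0 : ℝ) < k := by exact_mod_cast hkpos
    have hpi := Real.pi_pos
    have ht : t ≠ 0 := abs_pos.1 (hkr.trans_le hk)
    rw [norm_integral_Ico_fourierChar ht a hε]
    -- The sine is 1-Lipschitz and `|t|` is within 1 of `k`.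
    have h1 : |Real.sin (Real.pi * ε * |t|)| ≤ |Real.sin (Real.pi * ε * k)| + Real.pi * ε := by
      have h2 : |Real.sin (Real.pi * ε * |t|) - Real.sin (Real.pi * ε * k)| ≤
          |Real.pi * ε * |t| - Real.pi * ε * k| := by
        simpa [Real.dist_eq] using Real.lipschitzWith_sin.dist_le_mul (Real.pi * ε * |t|) (Real.pi * ε * k)
      have h3 : |Real.pi * ε * |t| - Real.pi * ε * k| ≤ Real.pi * ε := by
        rw [← mul_sub, abs_mul, abs_of_nonneg (by positivity : 0 ≤ Real.pi * ε),
          abs_of_nonneg (by linarith : 0 ≤ |t| - k)]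
        exact mul_le_of_le_one_right (by positivity) (by linarith)
      have h4 := abs_sub_abs_le_abs_sub (Real.sin (Real.pi * ε * |t|)) (Real.sin (Real.pi * ε * k))
      linarith
    calc (|Real.sin (Real.pi * ε * |t|)| / (Real.pi * |t|)) ^ 2
        ≤ ((|Real.sin (Real.pi * ε * k)| + Real.pi * ε) / (Real.pi * k)) ^ 2 := by gcongr
      _ = (|Real.sin (Real.pi * ε * k)| / (Real.pi * k) + ε / k) ^ 2 := by
          congr 1; field_simp
      _ ≤ (1 + δ) * (|Real.sin (Real.pi * ε * k)| / (Real.pi * k)) ^ 2 +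
            (1 + 1 / δ) * (ε / k) ^ 2 := add_sq_le_of_pos hδ
      _ = sincBound ε δ k := by
          rw [sincBound, if_neg hkpos.ne', div_pow |_|, sq_abs, div_pow, div_pow]
          ring

/-- `sincBound` as a function of the integer part of a frequency. -/
noncomputable def sincBoundInt (ε δ : ℝ) : ℤ → ℝ
  | Int.ofNat k => sincBound ε δ k
  -- For `⌊t⌋ = -(k + 1)`, `|t|` lies in `(k, k + 1]`, so the index is again `k`.
  | Int.negSucc k => sincBound ε δ k

lemma sincBoundInt_nonneg {ε δ : ℝ} (hδ : 0 < δ) (m : ℤ) : 0 ≤ sincBoundInt ε δ m := by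
  cases m <;> exact sincBound_nonneg hδ _

lemma norm_integral_Ico_fourierChar_sq_le_floor {ε δ : ℝ} (hε : 0 ≤ ε) (hδ : 0 < δ) (t a : ℝ) :
    ‖∫ x in Set.Ico a (a + ε), (Real.fourierChar (t * x) : ℂ)‖ ^ 2 ≤ sincBoundInt ε δ ⌊t⌋ := by
  have h1 := Int.floor_le t
  have h2 := Int.lt_floor_add_one t
  rcases hm : ⌊t⌋ with k | k
  · rw [hm] at h1 h2
    simp only [Int.ofNat_eq_natCast, Int.cast_natCast] at h1 h2
    have ht : |t| = t := abs_of_nonneg ((Nat.cast_nonneg k).trans h1)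
    exact norm_integral_Ico_fourierChar_sq_le hε hδ (by rw [ht]; exact h1) (by rw [ht]; exact h2.le) a
  · rw [hm] at h1 h2
    rw [Int.cast_negSucc] at h1 h2
    push_cast at h1 h2
    have hk : (0 : ℝ) ≤ k := Nat.cast_nonneg k
    have ht : |t| = -t := abs_of_nonpos (by linarith)
    exact norm_integral_Ico_fourierChar_sq_le hε hδ (by rw [ht]; linarith) (by rw [ht]; linarith) a

/-- For `ε = δ ^ 2` the relative errors `δ` and `ε / δ` are both of order `δ`. The two half-lines
together give the main term `ε`. -/
lemma sum_sincBoundInt_le {δ : ℝ} (hδ : 0 < δ) (hδ1 : δ ≤ 1) (M : Finset ℤ) :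
    ∑ m ∈ M, sincBoundInt (δ ^ 2) δ m ≤ δ ^ 2 * (1 + 10 * δ) := by
  have hs := hasSum_sincBound (ε := δ ^ 2) ⟨by positivity, pow_le_one₀ hδ.le hδ1⟩ δ
  have hint : HasSum (sincBoundInt (δ ^ 2) δ) _ := HasSum.of_nat_of_neg_add_one hs (by
    simp only [← Int.negSucc_eq]
    exact hs)
  refine (sum_le_hasSum M (fun m _ => sincBoundInt_nonneg hδ m) hint).trans ?_
  have hpi : Real.pi ^ 2 < 10 := by
    have := Real.pi_lt_d2
    nlinarith [Real.pi_pos]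
  have h1 : (1 + 1 / δ) * (δ ^ 2) ^ 2 = δ ^ 3 * (1 + δ) := by
    field_simp
    ring
  rw [h1]
  have h2 : δ ^ 3 * (1 + δ) * (Real.pi ^ 2 / 6) ≤ δ ^ 3 * (1 + δ) * (10 / 6) := by gcongr
  have h3 : δ ^ 3 * δ ≤ δ ^ 3 * 1 := by gcongr
  have h4 : 0 ≤ δ ^ 3 := by positivity
  have h5 : 0 ≤ δ ^ 3 * δ ^ 2 := by positivity
  nlinarith

lemma integral_pi_fourierChar {d : ℕ} (θ : Fin d → ℝ) (s : Fin d → Set ℝ) :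
    ∫ x in Set.pi Set.univ s, (Real.fourierChar (∑ i, θ i * x i) : ℂ) =
      ∏ i, ∫ x in s i, (Real.fourierChar (θ i * x) : ℂ) := by
  rw [volume_pi, Measure.restrict_pi_pi, ← integral_fintype_prod_eq_prod]
  refine integral_congr_ae (Filter.Eventually.of_forall fun x => ?_)
  simp only
  rw [AddChar.map_sum_eq_prod']
  exact map_prod Circle.coeHom _ _

lemma unionOfUnitCubes_eq {d : ℕ} (A : Finset (Fin d → ℤ)) :
    unionOfUnitCubes A =
      ⋃ a ∈ A, Set.pi Set.univ fun i => Set.Ico (a i : ℝ) ((a i : ℝ) + 1) := by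
  simp only [unionOfUnitCubes, Set.pi, Set.mem_univ, true_implies]

lemma mem_unionOfUnitCubes {d : ℕ} {A : Finset (Fin d → ℤ)} {x : Fin d → ℝ} :
    x ∈ unionOfUnitCubes A ↔ (fun i => ⌊x i⌋) ∈ A := by
  simp only [unionOfUnitCubes, Set.mem_iUnion, Set.mem_ofPred_eq, exists_prop, Set.mem_Ico,
    ← Int.floor_eq_iff]
  constructor
  · rintro ⟨a, ha, h⟩
    rwa [show (fun i => ⌊x i⌋) = a from funext h]
  · intro h
    exact ⟨_, h, fun i => rfl⟩

lemma pairwiseDisjoint_unitCubes {d : ℕ} (A : Set (Fin d → ℤ)) :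
    A.PairwiseDisjoint fun a => Set.pi Set.univ fun i => Set.Ico (a i : ℝ) ((a i : ℝ) + 1) := by
  intro a _ b _ hab
  rw [Function.onFun, Set.disjoint_left]
  intro x hx hy
  apply hab
  ext i
  have h1 := Int.floor_eq_iff.2 (hx i trivial)
  have h2 := Int.floor_eq_iff.2 (hy i trivial)
  exact h1.symm.trans h2

lemma measurableSet_unitCube {d : ℕ} (a : Fin d → ℤ) :
    MeasurableSet (Set.pi Set.univ fun i => Set.Ico (a i : ℝ) ((a i : ℝ) + 1)) :=
  MeasurableSet.univ_pi fun _ => measurableSet_Ico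

lemma volume_unionOfUnitCubes {d : ℕ} (A : Finset (Fin d → ℤ)) :
    volume (unionOfUnitCubes A) = #A := by
  rw [unionOfUnitCubes_eq, measure_biUnion_finset (pairwiseDisjoint_unitCubes _)
    fun a _ => measurableSet_unitCube a]
  simp [volume_pi_pi]

lemma integral_unionOfUnitCubes_fourierChar {d : ℕ} (A : Finset (Fin d → ℤ)) (θ : Fin d → ℝ) :
    ∫ x in unionOfUnitCubes A, (Real.fourierChar (∑ i, θ i * x i) : ℂ) =
      expSum A θ * ∏ i, ∫ x in Set.Ico (0 : ℝ) 1, (Real.fourierChar (θ i * x) : ℂ) := by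
  have hcont : Continuous fun x : Fin d → ℝ => (Real.fourierChar (∑ i, θ i * x i) : ℂ) :=
    continuous_subtype_val.comp (Real.continuous_fourierChar.comp (by fun_prop))
  rw [unionOfUnitCubes_eq, integral_biUnion_finset _ (fun a _ => measurableSet_unitCube a)
    (pairwiseDisjoint_unitCubes _), expSum, sum_mul]
  · refine sum_congr rfl fun a _ => ?_
    rw [integral_pi_fourierChar]
    simp only [integral_Ico_add_one_fourierChar]
    rw [prod_mul_distrib, AddChar.map_sum_eq_prod']
    congr 1
    exact (map_prod Circle.coeHom (fun i => Real.fourierChar (θ i * a i)) univ).symm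
  · intro a _
    refine Measure.integrableOn_of_bounded (M := 1) ?_ hcont.aestronglyMeasurable
      (ae_of_all _ fun x => (Circle.norm_coe _).le)
    rw [volume_pi_pi]
    simp

/-- The transform of the unit cube has no zero with all coordinates smaller than 1 in absolute
value, so the zero comes from `A`. -/
lemma expSum_eq_zero_of_orthogonal {d : ℕ} {A : Finset (Fin d → ℤ)} {θ : Fin d → ℝ}
    (hθ : ∀ i, |θ i| < 1)
    (h : ∫ x in unionOfUnitCubes A, (Real.fourierChar (∑ i, θ i * x i) : ℂ) = 0) :
    expSum A θ = 0 := by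
  rw [integral_unionOfUnitCubes_fourierChar, mul_eq_zero] at h
  refine h.resolve_right ?_
  exact prod_ne_zero_iff.2 fun i _ => integral_Ico_zero_one_fourierChar_ne_zero (hθ i)

/-! ### Density of frequencies and non-spectrality in `ℝ^d`. -/

/-- If unit cubes contain at most `K` of the frequencies `θ j`, a sum over the frequencies of a
function of their integer parts is at most `K` times its sum over the integer points. -/
lemma sum_floor_le {ι : Type*} {d : ℕ} (s : Finset ι) (θ : ι → Fin d → ℝ) {K : ℝ} (hK : 0 ≤ K)
    (hcard : ∀ m : Fin d → ℤ, (#(s.filter fun j => (fun i => ⌊θ j i⌋) = m) : ℝ) ≤ K)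
    (w : ℤ → ℝ) (hw : ∀ m, 0 ≤ w m) {W : ℝ} (hW : ∀ M : Finset ℤ, ∑ m ∈ M, w m ≤ W) :
    ∑ j ∈ s, ∏ i, w ⌊θ j i⌋ ≤ K * W ^ d := by
  classical
  let M : Fin d → Finset ℤ := fun i => s.image fun j => ⌊θ j i⌋
  have hmaps : ∀ j ∈ s, (fun i => ⌊θ j i⌋) ∈ Fintype.piFinset M := fun j hj => by
    rw [Fintype.mem_piFinset]
    exact fun i => mem_image_of_mem _ hj
  rw [← sum_fiberwise_of_maps_to hmaps]
  calc ∑ m ∈ Fintype.piFinset M, ∑ j ∈ s with (fun i => ⌊θ j i⌋) = m, ∏ i, w ⌊θ j i⌋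
      ≤ ∑ m ∈ Fintype.piFinset M, K * ∏ i, w (m i) := by
        refine sum_le_sum fun m _ => ?_
        have : ∑ j ∈ s with (fun i => ⌊θ j i⌋) = m, ∏ i, w ⌊θ j i⌋ =
            ∑ j ∈ s with (fun i => ⌊θ j i⌋) = m, ∏ i, w (m i) := by
          refine sum_congr rfl fun j hj => ?_
          rw [← (mem_filter.1 hj).2]
        rw [this, sum_const, nsmul_eq_mul]
        exact mul_le_mul_of_nonneg_right (hcard m) (prod_nonneg fun i _ => hw _)
    _ = K * ∏ i, ∑ m ∈ M i, w m := by rw [← mul_sum, prod_univ_sum]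
    _ ≤ K * ∏ _i : Fin d, W :=
        mul_le_mul_of_nonneg_left (prod_le_prod (fun i _ => sum_nonneg fun m _ => hw m)
          fun i _ => hW _) hK
    _ = K * W ^ d := by simp

/-- Frequencies in one unit cell are orthogonal for `A`, so there are at most `#A - 1` of them.
Parseval for a cube of side `δ ^ 2` inside the set then bounds `#A` by `(#A - 1) (1 + 10 δ) ^ d`,
which fails as `δ → 0`. -/
lemma not_isSpectral_unionOfUnitCubes {d : ℕ} {A : Finset (Fin d → ℤ)}
    (hA : ∀ S : Finset (Fin d → ℝ),
      (∀ θ ∈ S, ∀ θ' ∈ S, θ ≠ θ' → expSum A (θ - θ') = 0) → #S < #A) :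
    ¬ IsSpectral volume (unionOfUnitCubes A) := by
  classical
  rintro ⟨Λ, hΛ⟩
  have hApos : 0 < #A := by simpa using hA ∅ (by simp)
  obtain ⟨a, ha⟩ := card_pos.1 hApos
  have hvol := volume_unionOfUnitCubes A
  choose θ hθ using fun χ : Λ => exists_fourierChar_of_continuous (hΛ.continuous χ.1 χ.2)
  have inj : Function.Injective θ := fun χ ψ h => by
    apply Subtype.ext
    ext x
    rw [hθ χ x, hθ ψ x, h]
  have hcard : ∀ (s : Finset Λ) (m : Fin d → ℤ),
      (#(s.filter fun χ => (fun i => ⌊θ χ i⌋) = m) : ℝ) ≤ (#A : ℝ) - 1 := by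
    intro s m
    have := hA ((s.filter fun χ => (fun i => ⌊θ χ i⌋) = m).image θ) (by
      intro t ht t' ht' hne
      obtain ⟨χ, hχ, rfl⟩ := mem_image.1 ht
      obtain ⟨ψ, hψ, rfl⟩ := mem_image.1 ht'
      have hfloor := (mem_filter.1 hχ).2.trans (mem_filter.1 hψ).2.symm
      refine expSum_eq_zero_of_orthogonal
        (fun i => Int.abs_sub_lt_one_of_floor_eq_floor (congrFun hfloor i)) ?_
      rw [← hΛ.orthogonal χ.1 χ.2 ψ.1 ψ.2 fun h => hne (by rw [Subtype.ext h])]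
      simp only [fourierChar_sum_sub, ← hθ])
    rw [card_image_of_injective _ inj] at this
    have h2 : ((#(s.filter fun χ => (fun i => ⌊θ χ i⌋) = m) + 1 : ℕ) : ℝ) ≤ #A :=
      by exact_mod_cast this
    push_cast at h2
    linarith
  have hK : (0 : ℝ) ≤ (#A : ℝ) - 1 := by
    have : (1 : ℝ) ≤ #A := by exact_mod_cast hApos
    linarith
  have key : ∀ δ ∈ Set.Ioc (0 : ℝ) 1, (#A : ℝ) ≤ ((#A : ℝ) - 1) * (1 + 10 * δ) ^ d := by
    rintro δ ⟨hδ, hδ1⟩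
    have hε0 : 0 < δ ^ 2 := by positivity
    have hε1 : δ ^ 2 ≤ 1 := pow_le_one₀ hδ.le hδ1
    set Q : Set (Fin d → ℝ) := Set.pi Set.univ fun i => Set.Ico (a i : ℝ) (a i + δ ^ 2) with hQ
    have hsum := hΛ.hasSum (by rw [hvol]; simp) (by rw [hvol]; simpa using hApos.ne')
      (Q := Q) (MeasurableSet.univ_pi fun _ => measurableSet_Ico) (by
        rw [unionOfUnitCubes_eq]
        refine Set.subset_biUnion_of_mem (u := fun a : Fin d → ℤ =>
          Set.pi Set.univ fun i => Set.Ico (a i : ℝ) ((a i : ℝ) + 1)) ha |>.trans' ?_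
        exact Set.pi_mono fun i _ => Set.Ico_subset_Ico_right (by linarith))
    have hvolQ : volume.real Q = (δ ^ 2) ^ d := by
      rw [Measure.real, hQ, volume_pi_pi]
      simp [ENNReal.toReal_ofReal, hδ.le]
    have hvolA : volume.real (unionOfUnitCubes A) = #A := by simp [Measure.real, hvol]
    rw [hvolQ, hvolA] at hsum
    have hle : (#A : ℝ) * (δ ^ 2) ^ d ≤ ((#A : ℝ) - 1) * (δ ^ 2 * (1 + 10 * δ)) ^ d := by
      refine hasSum_le_of_sum_le hsum fun s => ?_
      refine (sum_le_sum fun χ _ => ?_).trans (sum_floor_le s θ hK (hcard s)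
        (sincBoundInt (δ ^ 2) δ) (sincBoundInt_nonneg hδ) (sum_sincBoundInt_le hδ hδ1))
      simp only [hθ χ]
      rw [hQ, integral_pi_fourierChar, norm_prod, ← prod_pow]
      exact prod_le_prod (fun i _ => by positivity) fun i _ =>
        norm_integral_Ico_fourierChar_sq_le_floor hε0.le hδ _ _
    rw [mul_pow, mul_left_comm, mul_comm (#A : ℝ)] at hle
    exact le_of_mul_le_mul_left hle (by positivity)
  have hlim : Filter.Tendsto (fun δ : ℝ => ((#A : ℝ) - 1) * (1 + 10 * δ) ^ d)
      (nhdsWithin 0 (Set.Ioi 0)) (nhds ((#A : ℝ) - 1)) := by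
    have : Continuous fun δ : ℝ => ((#A : ℝ) - 1) * (1 + 10 * δ) ^ d := by fun_prop
    have h := this.tendsto 0
    simp only [mul_zero, add_zero, one_pow, mul_one] at h
    exact h.mono_left nhdsWithin_le_nhds
  have := ge_of_tendsto hlim (by
    filter_upwards [Ioc_mem_nhdsGT (zero_lt_one' ℝ)] with δ hδ using key δ hδ)
  linarith

/-! ### Tilings of `ℝ^d`, the interior, and the conclusion. -/

lemma isTilingComplement_of_existsUnique {G : Type*} [AddCommGroup G] [MeasurableSpace G]
    {μ : Measure G} {Ω T : Set G} (h : ∀ᵐ x ∂μ, ∃! t, t ∈ T ∧ x - t ∈ Ω) :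
    IsTilingComplement μ Ω T := by
  filter_upwards [h] with x hx
  obtain ⟨t, ⟨htT, ht⟩, huniq⟩ := hx
  rw [tsum_eq_single ⟨t, htT⟩]
  · exact Set.indicator_of_mem ht _
  · rintro ⟨s, hs⟩ hne
    exact Set.indicator_of_notMem (fun hmem => hne (Subtype.ext (huniq s ⟨hs, hmem⟩))) _

lemma existsUnique_intCast_sub_mem {d : ℕ} {A : Set (Fin d → ℤ)} {T : Set (Fin d → ℤ)}
    {Ω : Set (Fin d → ℝ)} {x : Fin d → ℝ}
    (hΩ : ∀ t : Fin d → ℤ, (x - fun i => (t i : ℝ)) ∈ Ω ↔ (fun i => ⌊x i⌋) - t ∈ A)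
    (h : ∃! t, t ∈ T ∧ (fun i => ⌊x i⌋) - t ∈ A) :
    ∃! t, t ∈ (fun (t : Fin d → ℤ) (i : Fin d) => (t i : ℝ)) '' T ∧ x - t ∈ Ω := by
  obtain ⟨t, ⟨htT, ht⟩, huniq⟩ := h
  refine ⟨fun i => (t i : ℝ), ⟨⟨t, htT, rfl⟩, (hΩ t).2 ht⟩, ?_⟩
  rintro _ ⟨⟨s, hs, rfl⟩, hmem⟩
  rw [huniq s ⟨hs, (hΩ s).1 hmem⟩]

lemma sub_intCast_mem_unionOfUnitCubes {d : ℕ} {A : Finset (Fin d → ℤ)} (x : Fin d → ℝ)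
    (t : Fin d → ℤ) :
    (x - fun i => (t i : ℝ)) ∈ unionOfUnitCubes A ↔ (fun i => ⌊x i⌋) - t ∈ (A : Set _) := by
  rw [mem_unionOfUnitCubes, Finset.mem_coe]
  simp only [Pi.sub_apply, Int.floor_sub_intCast]
  rfl

lemma mem_interior_unionOfUnitCubes {d : ℕ} {A : Finset (Fin d → ℤ)} {x : Fin d → ℝ}
    (hx : ∀ (i : Fin d) (m : ℤ), x i ≠ m) :
    x ∈ interior (unionOfUnitCubes A) ↔ x ∈ unionOfUnitCubes A := by
  refine ⟨fun h => interior_subset h, fun h => ?_⟩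
  rw [mem_unionOfUnitCubes] at h
  rw [mem_interior]
  refine ⟨Set.pi Set.univ fun i => Set.Ioo (⌊x i⌋ : ℝ) (⌊x i⌋ + 1), ?_,
    isOpen_set_pi Set.finite_univ fun _ _ => isOpen_Ioo,
    fun i _ => ⟨(Int.floor_le _).lt_of_ne (hx i _).symm, Int.lt_floor_add_one _⟩⟩
  intro y hy
  rw [mem_unionOfUnitCubes]
  have : (fun i => ⌊y i⌋) = fun i => ⌊x i⌋ := by
    ext i
    exact Int.floor_eq_iff.2 ⟨(hy i trivial).1.le, (hy i trivial).2⟩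
  rwa [this]

lemma ae_forall_ne_intCast (d : ℕ) : ∀ᵐ x : Fin d → ℝ, ∀ (i : Fin d) (m : ℤ), x i ≠ m :=
  ae_all_iff.2 fun i => ae_all_iff.2 fun m => Measure.ae_eval_ne (μ := fun _ : Fin d => (volume : Measure ℝ)) i (m : ℝ)

lemma IsSpectrum.congr_ae {G : Type*} [AddCommGroup G] [TopologicalSpace G] [MeasurableSpace G]
    {μ : Measure G} {Ω Ω' : Set G} {Λ : Set (AddChar G Circle)} (h : IsSpectrum μ Ω Λ)
    (hΩ : Ω =ᵐ[μ] Ω') : IsSpectrum μ Ω' Λ := by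
  have e := Measure.restrict_congr_set hΩ
  refine ⟨h.continuous, ?_, ?_⟩
  · rw [← e]
    exact h.orthogonal
  · rw [← e]
    exact h.complete

theorem theorem4p3 (d : ℕ) (hd : 5 ≤ d) :
    ∃ A : Finset (Fin d → ℤ),
      (TilesByTranslation Measure.count (A : Set (Fin d → ℤ)) ∧
        ¬ IsSpectral Measure.count (A : Set (Fin d → ℤ))) ∧
      (TilesByTranslation volume (unionOfUnitCubes A) ∧
        ¬ IsSpectral volume (unionOfUnitCubes A)) ∧
      (TilesByTranslation volume (interior (unionOfUnitCubes A)) ∧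
        ¬ IsSpectral volume (interior (unionOfUnitCubes A))) := by
  let i₀ : Fin d := ⟨0, by omega⟩
  obtain ⟨n, hn, hA⟩ := exists_card_lt_card_liftBox (layeredTile i₀)
    (card_lt_card_layeredTile hd i₀)
  have : NeZero n := ⟨hn⟩
  obtain ⟨T, htile⟩ : ∃ T : Set (Fin d → ℤ), ∀ x, ∃! t, t ∈ T ∧ x - t ∈ liftBox _ n :=
    ⟨_, existsUnique_sub_mem_liftBox (existsUnique_crossPoint hd i₀)⟩
  set A := liftBox (layeredTile i₀) n
  -- The two sets can differ only at points with an integer coordinate, a null set.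
  have hae : interior (unionOfUnitCubes A) =ᵐ[volume] unionOfUnitCubes A := by
    filter_upwards [ae_forall_ne_intCast d] with x hx
    exact propext (mem_interior_unionOfUnitCubes hx)
  refine ⟨A, ⟨⟨T, isTilingComplement_of_existsUnique (.of_forall htile)⟩,
    not_isSpectral_count hA⟩, ⟨⟨_, isTilingComplement_of_existsUnique (.of_forall fun x =>
      existsUnique_intCast_sub_mem (sub_intCast_mem_unionOfUnitCubes x) (htile _))⟩,
    not_isSpectral_unionOfUnitCubes hA⟩,
    ⟨⟨(fun (t : Fin d → ℤ) (i : Fin d) => (t i : ℝ)) '' T,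
      isTilingComplement_of_existsUnique ?_⟩, ?_⟩⟩
  · filter_upwards [ae_forall_ne_intCast d] with x hx
    refine existsUnique_intCast_sub_mem (fun t => ?_) (htile _)
    rw [mem_interior_unionOfUnitCubes, sub_intCast_mem_unionOfUnitCubes]
    intro i m h
    simp only [Pi.sub_apply] at h
    exact hx i (m + t i) (by push_cast; linarith)
  · rintro ⟨Λ, hΛ⟩
    exact not_isSpectral_unionOfUnitCubes hA ⟨Λ, hΛ.congr_ae hae⟩
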